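/- All systems are finite dimensional. Setting. Let A have Hilbert space $\mathcal H_A\neq 0$ of dimension $n$, and let $R$ be a convex, non-negative, bounded real function of the states of A. Let $R^{sup}=\sup R$ over all states of A. For a state $\sigma$ of any system, with rank $r$ and nonzero eigenvalues $\lambda_1\ge\dots\ge\lambda_r$, let $G(\sigma)=\sup_{\{|i\rangle\}}R\big(\sum_{i=1}^r\lambda_i|i\rangle\langle i|\big)$, over the orthonormal bases of $\mathcal H_A$, if $r\le n$, and $G(\sigma)=0$ if $r>n$. Let $S(\sigma)=R^{sup}-G(\sigma)$. A bipartite entanglement monotone is a real function $E$ of the states of all bipartite systems that is non-negative, vanishes for separable states, and does not increase under finite-round local operations and classical communication (LOCC), with Kraus operators $K_q$, in at least one of the two senses (1) $E\big(\sum_qK_q\rho K_q^\dagger\big)\le E(\rho)$ (when all $K_q$ have the same target space), or (2) $\sum_{q:p_q>0}p_qE(K_q\rho K_q^\dagger/p_q)\le E(\rho)$, with $p_q=\operatorname{tr}(K_q\rho K_q^\dagger)$. We say that $E$ realizes $S$ on a system C if $S(\sigma)=\max E(\rho)$ for every state $\sigma$ of C, with the maximum over all systems B and all states $\rho$ of C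 and B with $\operatorname{tr}_B\rho=\sigma$. The convex roof is $E^{cr}(\rho)=\inf\sum_kP_kS(\operatorname{tr}_B|\Psi_k\rangle\langle\Psi_k|)$, over the finite ensembles of pure states with $\sum_kP_k|\Psi_k\rangle\langle\Psi_k|=\rho$. Part I. For every such $R$: (a) $G(|\psi\rangle\langle\psi|)=R^{sup}$ for every pure state $|\psi\rangle$ of any system. (b) If $E$ is an entanglement monotone that realizes $S$ on A, then for every system B and every state $\rho$ of A and B, with $\rho_A=\operatorname{tr}_B\rho$, $$R(\rho_A)+E(\rho)\le R^{sup}.$$ (c) $E^{cr}$ is an entanglement monotone, in both senses (1) and (2), and realizes $S$ on every system; in particular $R(\rho_A)+E^{cr}(\rho)\le R^{sup}$. Part II. Consider any resource theory: for every $\boldsymbol d=(d_1,d_2,\dots)$ a set of free states on $\mathcal H_{\boldsymbol d}=\mathbb C^{d_1}\otimes\mathbb C^{d_2}\otimes\cdots$, and a class of free operations given by finite families of Kraus operators $K_q:\mathcal H_{\boldsymbol d}\to\mathcal H_{\boldsymbol d_q}$ with $\sum_qK_q^\dagger K_q=1$. Let $\{R_{\boldsymbol d}\}$ be a measure of the resource,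 i.e. non-negative functions of the states on the $\mathcal H_{\boldsymbol d}$ that vanish for free states and do not increase under the free operations, in the sense (1) or in the sense (2). Let $R^{ch}_{\boldsymbol d}$ be the convex hull of $R_{\boldsymbol d}$, that is, the largest convex function on the states not larger than $R_{\boldsymbol d}$; it exists. Then $\{R^{ch}_{\boldsymbol d}\}$ is a measure of the same resource that consists of convex functions; it satisfies (1), and it satisfies (2) if $\{R_{\boldsymbol d}\}$ does. For every $\boldsymbol d$ such that $R^{ch}_{\boldsymbol d}$ is bounded, (b) and (c) hold for the system A with Hilbert space $\mathcal H_{\boldsymbol d}$ and $R=R^{ch}_{\boldsymbol d}$: every entanglement monotone $E$ that realizes the corresponding $S$ on A, and in particular the convex roof built from $S$, satisfies $R^{ch}_{\boldsymbol d}(\rho_A)+E(\rho)\le \sup R^{ch}_{\boldsymbol d}$. -/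

import Mathlib

open scoped Kronecker Matrix ComplexOrder

noncomputable section

/-! ## States of finite systems

The Hilbert space of a finite system is `ℂ^X` for a finite type `X`; a bipartite system has the
Hilbert space `ℂ^X ⊗ ℂ^Y = ℂ^(X × Y)`. -/

/-- The density matrices of the system with Hilbert space `ℂ^X`. -/
def densityMatrices (X : Type) [Fintype X] : Set (Matrix X X ℂ) :=
  {ρ | ρ.PosSemidef ∧ ρ.trace = 1}

/-- The rank-one operator `|ψ⟩⟨ψ|`. -/
def ketBra {X : Type} (ψ : X → ℂ) : Matrix X X ℂ :=
  Matrix.vecMulVec ψ (star ψ)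

/-- `ψ` is a normalised vector of `ℂ^X`. -/
def IsUnitVector {X : Type} [Fintype X] (ψ : X → ℂ) : Prop :=
  ∑ x, ‖ψ x‖ ^ 2 = 1

/-- The partial trace `tr_B` of an operator on `ℂ^X ⊗ ℂ^Y`. -/
def partialTraceB {X Y : Type} [Fintype Y] (ρ : Matrix (X × Y) (X × Y) ℂ) : Matrix X X ℂ :=
  Matrix.of fun i j => ∑ k, ρ (i, k) (j, k)

/-! ## The function `G`, the supremum of `R` and the entropy `S` -/

/-- The eigenvalues `λ_0(M) ≥ λ_1(M) ≥ ...` of a Hermitian matrix, counted with multiplicity and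
followed by zeros. -/
def sortedEigenvalue {Z : Type} [Fintype Z] [DecidableEq Z] (M : Matrix Z Z ℂ) (i : ℕ) : ℝ :=
  open Classical in
  if h : M.IsHermitian ∧ i < Fintype.card Z then h.1.eigenvalues₀ ⟨i, h.2⟩ else 0

/-- For a function `R` of the states of `ℂ^X` and a state `σ` of any finite system: the supremum of
`R (∑ i, λ_i(σ) |b_i⟩⟨b_i|)` over the orthonormal bases `b` of `ℂ^X` if the rank of `σ` is at most
the dimension of `ℂ^X`, and `0` otherwise. (In the first case `λ_i(σ) = 0` for `rank σ ≤ i`, so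
that only the nonzero eigenvalues of `σ` appear in the sum.) -/
def spectralSup {X : Type} [Fintype X] (R : Matrix X X ℂ → ℝ)
    {Z : Type} [Fintype Z] [DecidableEq Z] (σ : Matrix Z Z ℂ) : ℝ :=
  if σ.rank ≤ Fintype.card X then
    sSup {x | ∃ b : OrthonormalBasis (Fin (Fintype.card X)) ℂ (EuclideanSpace ℂ X),
      x = R (∑ i : Fin (Fintype.card X), sortedEigenvalue σ i • ketBra (fun a => b i a))}
  else 0

/-- The supremum `R^sup` of `R` over the states of `ℂ^X`. -/
def stateSup {X : Type} [Fintype X] (R : Matrix X X ℂ → ℝ) : ℝ :=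
  sSup (R '' densityMatrices X)

/-- The entropy `S = R^sup - G`, defined for the states of any finite system. -/
def resourceEntropy {X : Type} [Fintype X] (R : Matrix X X ℂ → ℝ)
    {Z : Type} [Fintype Z] [DecidableEq Z] (σ : Matrix Z Z ℂ) : ℝ :=
  stateSup R - spectralSup R σ

/-! ## Bipartite entanglement monotones -/

/-- A real function of the states of all finite bipartite systems. -/
abbrev BipartiteFunction : Type 1 :=
  ∀ (X Y : Type) [Fintype X] [DecidableEq X] [Fintype Y] [DecidableEq Y],
    Matrix (X × Y) (X × Y) ℂ → ℝ

/-- Separable states: finite convex combinations of product states. -/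
def IsSeparableState {X Y : Type} [Fintype X] [Fintype Y] (ρ : Matrix (X × Y) (X × Y) ℂ) : Prop :=
  ∃ (n : ℕ) (p : Fin n → ℝ) (σ : Fin n → Matrix X X ℂ) (τ : Fin n → Matrix Y Y ℂ),
    (∀ k, 0 ≤ p k) ∧ ∑ k, p k = 1 ∧ (∀ k, σ k ∈ densityMatrices X) ∧
    (∀ k, τ k ∈ densityMatrices Y) ∧ ρ = ∑ k, p k • (σ k ⊗ₖ τ k)

/-- `IsLOCC X Y ι X' Y' K`: the Kraus operators `K q : ℂ^X ⊗ ℂ^Y → ℂ^(X' q) ⊗ ℂ^(Y' q)`, `q : ι`,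
are those of an operation achieved by local operations and classical communication in finitely many
rounds: do nothing, or let one of the two parties make a local measurement (with Kraus operators
`M i`, possibly between spaces of different dimensions) and, depending on its outcome `i`, which is
communicated to the other party, continue with a further such operation. -/
inductive IsLOCC : ∀ (X Y : Type) [Fintype X] [DecidableEq X] [Fintype Y] [DecidableEq Y]
    (ι : Type) [Fintype ι] (X' Y' : ι → Type)
    [∀ q, Fintype (X' q)] [∀ q, DecidableEq (X' q)]
    [∀ q, Fintype (Y' q)] [∀ q, DecidableEq (Y' q)],
    (∀ q, Matrix (X' q × Y' q) (X × Y) ℂ) → Prop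
  | done (X Y : Type) [Fintype X] [DecidableEq X] [Fintype Y] [DecidableEq Y] :
      IsLOCC X Y Unit (fun _ => X) (fun _ => Y) (fun _ => 1)
  | alice (X Y : Type) [Fintype X] [DecidableEq X] [Fintype Y] [DecidableEq Y]
      (n : ℕ) (W : Fin n → Type) [∀ i, Fintype (W i)] [∀ i, DecidableEq (W i)]
      (M : ∀ i, Matrix (W i) X ℂ) (hM : ∑ i, (M i)ᴴ * M i = 1)
      (κ : Fin n → Type) [∀ i, Fintype (κ i)] (X' Y' : ∀ i, κ i → Type)
      [∀ i j, Fintype (X' i j)] [∀ i j, DecidableEq (X' i j)]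
      [∀ i j, Fintype (Y' i j)] [∀ i j, DecidableEq (Y' i j)]
      (L : ∀ i j, Matrix (X' i j × Y' i j) (W i × Y) ℂ)
      (hL : ∀ i, IsLOCC (W i) Y (κ i) (X' i) (Y' i) (L i)) :
      IsLOCC X Y (Σ i, κ i) (fun q => X' q.1 q.2) (fun q => Y' q.1 q.2)
        (fun q => L q.1 q.2 * (M q.1 ⊗ₖ (1 : Matrix Y Y ℂ)))
  | bob (X Y : Type) [Fintype X] [DecidableEq X] [Fintype Y] [DecidableEq Y]
      (n : ℕ) (W : Fin n → Type) [∀ i, Fintype (W i)] [∀ i, DecidableEq (W i)]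
      (M : ∀ i, Matrix (W i) Y ℂ) (hM : ∑ i, (M i)ᴴ * M i = 1)
      (κ : Fin n → Type) [∀ i, Fintype (κ i)] (X' Y' : ∀ i, κ i → Type)
      [∀ i j, Fintype (X' i j)] [∀ i j, DecidableEq (X' i j)]
      [∀ i j, Fintype (Y' i j)] [∀ i j, DecidableEq (Y' i j)]
      (L : ∀ i j, Matrix (X' i j × Y' i j) (X × W i) ℂ)
      (hL : ∀ i, IsLOCC X (W i) (κ i) (X' i) (Y' i) (L i)) :
      IsLOCC X Y (Σ i, κ i) (fun q => X' q.1 q.2) (fun q => Y' q.1 q.2)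
        (fun q => L q.1 q.2 * ((1 : Matrix X X ℂ) ⊗ₖ M q.1))

/-- The probability `tr (K† K ρ) = tr (K ρ K†)` of the outcome with Kraus operator `K`. -/
def outcomeProb {X X' : Type} [Fintype X] [Fintype X'] (K : Matrix X' X ℂ) (ρ : Matrix X X ℂ) : ℝ :=
  (K * ρ * Kᴴ).trace.re

/-- The state `K ρ K† / tr (K ρ K†)` after the outcome with Kraus operator `K`. -/
def outcomeState {X X' : Type} [Fintype X] [Fintype X'] (K : Matrix X' X ℂ) (ρ : Matrix X X ℂ) :
    Matrix X' X' ℂ :=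
  (outcomeProb K ρ)⁻¹ • (K * ρ * Kᴴ)

/-- `E` does not increase when an operation achieved by local operations and classical communication
is performed and its outcome is discarded. -/
def LOCCMonotone (E : BipartiteFunction) : Prop :=
  ∀ (X Y : Type) [Fintype X] [DecidableEq X] [Fintype Y] [DecidableEq Y]
    (ι : Type) [Fintype ι] (X' Y' : Type)
    [Fintype X'] [DecidableEq X'] [Fintype Y'] [DecidableEq Y']
    (K : ι → Matrix (X' × Y') (X × Y) ℂ), IsLOCC X Y ι (fun _ => X') (fun _ => Y') K →
    ∀ ρ ∈ densityMatrices (X × Y), E X' Y' (∑ q, K q * ρ * (K q)ᴴ) ≤ E X Y ρ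

/-- `E` does not increase on average under local operations and classical communication. (Outcomes
of probability zero contribute zero to the sum.) -/
def LOCCMonotoneOnAverage (E : BipartiteFunction) : Prop :=
  ∀ (X Y : Type) [Fintype X] [DecidableEq X] [Fintype Y] [DecidableEq Y]
    (ι : Type) [Fintype ι] (X' Y' : ι → Type)
    [∀ q, Fintype (X' q)] [∀ q, DecidableEq (X' q)]
    [∀ q, Fintype (Y' q)] [∀ q, DecidableEq (Y' q)]
    (K : ∀ q, Matrix (X' q × Y' q) (X × Y) ℂ), IsLOCC X Y ι X' Y' K →
    ∀ ρ ∈ densityMatrices (X × Y),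
      ∑ q, outcomeProb (K q) ρ * E (X' q) (Y' q) (outcomeState (K q) ρ) ≤ E X Y ρ

/-- Bipartite entanglement monotones: non-negative functions of the bipartite states that vanish for
separable states and do not increase under local operations and classical communication, in one of
the two usual senses. -/
structure IsEntanglementMonotone (E : BipartiteFunction) : Prop where
  nonneg : ∀ (X Y : Type) [Fintype X] [DecidableEq X] [Fintype Y] [DecidableEq Y],
    ∀ ρ ∈ densityMatrices (X × Y), 0 ≤ E X Y ρ
  separable : ∀ (X Y : Type) [Fintype X] [DecidableEq X] [Fintype Y] [DecidableEq Y]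
    (ρ : Matrix (X × Y) (X × Y) ℂ), IsSeparableState ρ → E X Y ρ = 0
  monotone : LOCCMonotone E ∨ LOCCMonotoneOnAverage E

/-- For every state `ρ_A` of the system A with Hilbert space `ℂ^Z`, `S ρ_A` is the maximum of `E ρ`
over the states `ρ` of the systems consisting of A and any finite system B with `tr_B ρ = ρ_A`. -/
def IsMaxOverExtensions (Z : Type) [Fintype Z] [DecidableEq Z] (S : Matrix Z Z ℂ → ℝ)
    (E : BipartiteFunction) : Prop :=
  ∀ σ ∈ densityMatrices Z,
    IsGreatest {x | ∃ (Y : Type) (_ : Fintype Y) (_ : DecidableEq Y)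
      (ρ : Matrix (Z × Y) (Z × Y) ℂ),
        ρ ∈ densityMatrices (Z × Y) ∧ partialTraceB ρ = σ ∧ x = E Z Y ρ} (S σ)

/-- The convex roof `E^cr(ρ) = inf ∑ k, P_k S(tr_B |Ψ_k⟩⟨Ψ_k|)` built from the entropy `S` of `R`,
with the infimum over the finite ensembles such that `∑ k, P_k |Ψ_k⟩⟨Ψ_k| = ρ`. -/
def convexRoof {W : Type} [Fintype W] (R : Matrix W W ℂ → ℝ) : BipartiteFunction :=
  fun X Y _ _ _ _ ρ =>
    sInf {x | ∃ (n : ℕ) (P : Fin n → ℝ) (Ψ : Fin n → X × Y → ℂ),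
      (∀ k, 0 ≤ P k) ∧ (∀ k, IsUnitVector (Ψ k)) ∧ ∑ k, P k • ketBra (Ψ k) = ρ ∧
      x = ∑ k, P k * resourceEntropy R (partialTraceB (ketBra (Ψ k)))}

/-! ## Resource theories and their measures -/

/-- An index set for the product basis of `ℂ^(d_1) ⊗ ℂ^(d_2) ⊗ ...`, where `d = (d_1, d_2, ...)`. -/
abbrev SpaceIndex (d : List ℕ+) : Type := ∀ i : Fin d.length, Fin (d.get i : ℕ)

/-- A quantum resource theory: free states for every `d = (d_1, d_2, ...)`, and free operations,
given by Kraus operators `K q` from the space of `d` to that of `t q` for the outcomes `q`, with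
`∑ q, (K q)† (K q) = 1`. The usual further demand that free operations preserve free states is not
imposed, so that the notion covers every version of it. -/
structure ResourceTheory where
  free : ∀ d : List ℕ+, Set (Matrix (SpaceIndex d) (SpaceIndex d) ℂ)
  free_subset : ∀ d, free d ⊆ densityMatrices (SpaceIndex d)
  freeOp : ∀ (d : List ℕ+) (n : ℕ) (t : Fin n → List ℕ+),
    (∀ q, Matrix (SpaceIndex (t q)) (SpaceIndex d) ℂ) → Prop
  freeOp_complete : ∀ d n t K, freeOp d n t K → ∑ q, (K q)ᴴ * K q = 1

/-- A family of real functions, one on the operators of each space. -/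
abbrev ResourceFunction : Type :=
  ∀ d : List ℕ+, Matrix (SpaceIndex d) (SpaceIndex d) ℂ → ℝ

/-- `R` does not increase under the free operations with discarded outcome. -/
def ResourceTheory.MonotoneFor (T : ResourceTheory) (R : ResourceFunction) : Prop :=
  ∀ (d d' : List ℕ+) (n : ℕ) (K : Fin n → Matrix (SpaceIndex d') (SpaceIndex d) ℂ),
    T.freeOp d n (fun _ => d') K → ∀ ρ ∈ densityMatrices (SpaceIndex d),
      R d' (∑ q, K q * ρ * (K q)ᴴ) ≤ R d ρ

/-- `R` does not increase on average under the free operations. -/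
def ResourceTheory.MonotoneOnAverageFor (T : ResourceTheory) (R : ResourceFunction) : Prop :=
  ∀ (d : List ℕ+) (n : ℕ) (t : Fin n → List ℕ+)
    (K : ∀ q, Matrix (SpaceIndex (t q)) (SpaceIndex d) ℂ),
    T.freeOp d n t K → ∀ ρ ∈ densityMatrices (SpaceIndex d),
      ∑ q, outcomeProb (K q) ρ * R (t q) (outcomeState (K q) ρ) ≤ R d ρ

/-- Measures of the resource: non-negative, zero for free states, and not increasing under free
operations in one of the two senses. -/
structure ResourceTheory.IsMeasure (T : ResourceTheory) (R : ResourceFunction) : Prop where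
  nonneg : ∀ d, ∀ ρ ∈ densityMatrices (SpaceIndex d), 0 ≤ R d ρ
  free : ∀ d, ∀ ρ ∈ T.free d, R d ρ = 0
  monotone : T.MonotoneFor R ∨ T.MonotoneOnAverageFor R

/-- The convex hull of a function of the states of `ℂ^X`: the largest convex function that is not
larger than it. -/
def convexHullFunction {X : Type} [Fintype X] (R : Matrix X X ℂ → ℝ) (ρ : Matrix X X ℂ) : ℝ :=
  sSup {x | ∃ g : Matrix X X ℂ → ℝ, ConvexOn ℝ (densityMatrices X) g ∧
    (∀ σ ∈ densityMatrices X, g σ ≤ R σ) ∧ x = g ρ}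

/-- The family of the convex hulls of the functions `R d`. -/
def ResourceFunction.hull (R : ResourceFunction) : ResourceFunction :=
  fun d => convexHullFunction (R d)

end

/-! ## Rank-one operators -/

/-! The key is a basis-free form of `G`: `spectralSup R σ` is the supremum of `R (V σ V†)` over the
operators `V` that are isometric on the support of `σ` (`spectralSup_eq_sSup_partialIsometry`). If
`V` is isometric on the support of a mixture, it is so on the support of each component; hence
convexity of `R` passes to `G`, and `S` is concave (`concaveOn_resourceEntropy`). At a pure state
`V` reaches every pure state of A, and a convex function has its supremum on pure states, so `S`
vanishes there.

`S` depends only on the nonzero spectrum, so the two reduced states of a pure bipartite state have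
equal entropy. A measurement by one party preserves the other party's reduced state on average;
concavity then makes the entropy of entanglement of pure states decrease on average under LOCC
(`IsLOCC.sum_pureEntropy_le`), and the convex roof carries this to mixed states. Concavity also
gives `E^cr(ρ) ≤ S(ρ_A)`, with equality at purifications. The inequality with `R` follows from `E ≤
S(ρ_A)` and `R ≤ G` (take `V = 1`).

For Part II, the hull is the pointwise supremum of the convex minorants. The hull evaluated after a
free operation is itself a convex minorant of the original measure, hence lies below the hull.

Normalisation is avoided throughout by `homExt`, which turns convexity into subadditivity on
positive operators and lets ensembles be families of unnormalised vectors. -/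

theorem mul_ketBra_mul_conjTranspose {X Y : Type} [Fintype X] (K : Matrix Y X ℂ) (ψ : X → ℂ) :
    K * ketBra ψ * Kᴴ = ketBra (K *ᵥ ψ) := by
  rw [ketBra, ketBra, Matrix.mul_vecMulVec, Matrix.vecMulVec_mul, Matrix.star_mulVec]

theorem ketBra_smul {X : Type} (c : ℂ) (ψ : X → ℂ) :
    ketBra (c • ψ) = (‖c‖ ^ 2 : ℝ) • ketBra ψ := by
  ext i j
  have h : c * star c = ((‖c‖ ^ 2 : ℝ) : ℂ) := by
    rw [Complex.star_def, Complex.mul_conj, Complex.normSq_eq_norm_sq]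
  simp only [ketBra, Matrix.vecMulVec_apply, Pi.smul_apply, Pi.star_apply, smul_eq_mul, star_mul,
    Matrix.smul_apply, Complex.real_smul, ← h]
  ring

theorem ketBra_posSemidef {X : Type} [Fintype X] (ψ : X → ℂ) : (ketBra ψ).PosSemidef :=
  Matrix.posSemidef_vecMulVec_self_star ψ

theorem trace_ketBra {X : Type} [Fintype X] (ψ : X → ℂ) :
    (ketBra ψ).trace = ((∑ x, ‖ψ x‖ ^ 2 : ℝ) : ℂ) := by
  simp only [Matrix.trace, ketBra, Matrix.diag_apply, Matrix.vecMulVec_apply, Pi.star_apply,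
    Complex.star_def, Complex.mul_conj, Complex.normSq_eq_norm_sq]
  push_cast; rfl

theorem ketBra_mem_densityMatrices {X : Type} [Fintype X] {ψ : X → ℂ} (h : IsUnitVector ψ) :
    ketBra ψ ∈ densityMatrices X :=
  ⟨ketBra_posSemidef ψ, by rw [trace_ketBra, h]; simp⟩

theorem star_dotProduct_self_of_isUnitVector {X : Type} [Fintype X] {ψ : X → ℂ}
    (h : IsUnitVector ψ) : star ψ ⬝ᵥ ψ = 1 := by
  have h1 := trace_ketBra ψ
  rw [h] at h1
  rw [ketBra, Matrix.trace_vecMulVec, dotProduct_comm] at h1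
  simpa using h1

theorem mul_conjTranspose_eq_sum_ketBra {X Y : Type} [Fintype Y] (A : Matrix X Y ℂ) :
    A * Aᴴ = ∑ k, ketBra (fun x => A x k) := by
  ext i j
  simp [Matrix.mul_apply, Matrix.sum_apply, ketBra, Matrix.vecMulVec_apply]

open scoped MatrixOrder Matrix.Norms.L2Operator in
theorem exists_eq_mul_conjTranspose {Z : Type} [Fintype Z] {σ : Matrix Z Z ℂ}
    (h : σ.PosSemidef) : ∃ B : Matrix Z Z ℂ, B * Bᴴ = σ := by
  classical
  obtain ⟨B, hB⟩ := CStarAlgebra.nonneg_iff_eq_mul_star_self.mp h.nonneg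
  exact ⟨B, hB.symm⟩

/-! ## Sorted eigenvalues -/

/-- Zeros come last in a decreasing list of non-negative numbers. This allows spectra of matrices of
different sizes to be compared by padding. -/
theorem sort_add_replicate_zero {s : Multiset ℝ} (hs : ∀ x ∈ s, 0 ≤ x) (k : ℕ) :
    (s + Multiset.replicate k 0).sort (· ≥ ·) = s.sort (· ≥ ·) ++ List.replicate k 0 := by
  conv_lhs => rw [← Multiset.sort_eq s (· ≥ ·), ← Multiset.coe_replicate, Multiset.coe_add,
    Multiset.coe_sort]
  apply List.mergeSort_of_pairwise
  simp only [decide_eq_true_eq]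
  rw [List.pairwise_append]
  refine ⟨Multiset.pairwise_sort _ _, List.pairwise_replicate.2 (Or.inr le_rfl), ?_⟩
  intro a ha b hb
  rw [List.eq_of_mem_replicate hb]
  exact hs a (by simpa using ha)

theorem sortedEigenvalue_eq_getD {Z : Type} [Fintype Z] [DecidableEq Z] {M : Matrix Z Z ℂ}
    (hM : M.IsHermitian) (i : ℕ) :
    sortedEigenvalue M i = ((M.charpoly.roots.map RCLike.re).sort (· ≥ ·)).getD i 0 := by
  rw [hM.sort_roots_charpoly_eq_eigenvalues₀, sortedEigenvalue]
  by_cases h : i < Fintype.card Z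
  · rw [dif_pos ⟨hM, h⟩, List.getD_eq_getElem _ _ (by simpa using h)]
    simp
  · rw [dif_neg (fun h' => h h'.2), List.getD_eq_default _ _ (by simpa using h)]

theorem re_roots_charpoly_nonneg {Z : Type} [Fintype Z] [DecidableEq Z] {M : Matrix Z Z ℂ}
    (hM : M.PosSemidef) : ∀ x ∈ M.charpoly.roots.map RCLike.re, (0 : ℝ) ≤ x := by
  intro x hx
  rw [hM.1.roots_charpoly_eq_eigenvalues, Multiset.map_map] at hx
  obtain ⟨i, -, rfl⟩ := Multiset.mem_map.1 hx
  simpa using hM.eigenvalues_nonneg i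

open Polynomial in
-- The powers of `X` pad both root multisets with zeros to a common size. Such padding is invisible
-- to `getD` with default `0`.
theorem sortedEigenvalue_congr {Z W : Type} [Fintype Z] [DecidableEq Z] [Fintype W]
    [DecidableEq W] {M : Matrix Z Z ℂ} {N : Matrix W W ℂ} (hM : M.PosSemidef) (hN : N.PosSemidef)
    (h : X ^ Fintype.card W * M.charpoly = X ^ Fintype.card Z * N.charpoly) :
    sortedEigenvalue M = sortedEigenvalue N := by
  funext i
  have h1 := congrArg (fun p => (p.roots.map (RCLike.re : ℂ → ℝ)).sort (· ≥ ·)) h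
  rw [roots_mul (mul_ne_zero (pow_ne_zero _ X_ne_zero) M.charpoly_monic.ne_zero),
    roots_mul (mul_ne_zero (pow_ne_zero _ X_ne_zero) N.charpoly_monic.ne_zero),
    roots_X_pow, roots_X_pow, Multiset.map_add, Multiset.map_add, Multiset.nsmul_singleton,
    Multiset.nsmul_singleton, Multiset.map_replicate, Multiset.map_replicate, map_zero,
    add_comm, sort_add_replicate_zero (re_roots_charpoly_nonneg hM), add_comm,
    sort_add_replicate_zero (re_roots_charpoly_nonneg hN)] at h1
  have key : ∀ (l : List ℝ) (k : ℕ), (l ++ List.replicate k 0).getD i 0 = l.getD i 0 := by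
    intro l k
    rcases lt_or_ge i l.length with hi | hi
    · rw [List.getD_append _ _ _ _ hi]
    · rw [List.getD_append_right _ _ _ _ hi, List.getD_eq_default _ _ hi,
        List.getD_eq_getElem?_getD, List.getElem?_replicate]
      split_ifs <;> rfl
  rw [sortedEigenvalue_eq_getD hM.1, sortedEigenvalue_eq_getD hN.1, ← key, h1, key]

theorem sortedEigenvalue_mul_conjTranspose {X Y : Type} [Fintype X] [DecidableEq X] [Fintype Y]
    [DecidableEq Y] (A : Matrix X Y ℂ) :
    sortedEigenvalue (A * Aᴴ) = sortedEigenvalue (Aᴴ * A) :=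
  sortedEigenvalue_congr (Matrix.posSemidef_self_mul_conjTranspose A)
    (Matrix.posSemidef_conjTranspose_mul_self A) (Matrix.charpoly_mul_comm' A Aᴴ)

theorem sortedEigenvalue_transpose {X : Type} [Fintype X] [DecidableEq X] {M : Matrix X X ℂ}
    (hM : M.PosSemidef) : sortedEigenvalue Mᵀ = sortedEigenvalue M :=
  sortedEigenvalue_congr hM.transpose hM (by rw [Matrix.charpoly_transpose])

/-- A positive eigenvalue at position `i` would make all those at positions `0, ..., i` positive,
while the rank counts the nonzero eigenvalues. -/
theorem sortedEigenvalue_eq_zero {Z : Type} [Fintype Z] [DecidableEq Z] {M : Matrix Z Z ℂ}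
    (hM : M.PosSemidef) {i : ℕ} (hi : M.rank ≤ i) : sortedEigenvalue M i = 0 := by
  by_cases h : i < Fintype.card Z
  · by_contra hne
    rw [sortedEigenvalue, dif_pos ⟨hM.1, h⟩] at hne
    have hnn : ∀ j, 0 ≤ hM.1.eigenvalues₀ j := fun j => by
      have := hM.eigenvalues_nonneg (Fintype.equivOfCardEq (Fintype.card_fin _) j)
      simpa [Matrix.IsHermitian.eigenvalues] using this
    have hpos : 0 < hM.1.eigenvalues₀ ⟨i, h⟩ := lt_of_le_of_ne (hnn _) (Ne.symm hne)
    have hle : i + 1 ≤ M.rank := by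
      rw [hM.1.rank_eq_card_non_zero_eigs]
      let f : Fin (i + 1) → {z // hM.1.eigenvalues z ≠ 0} := fun j =>
        ⟨Fintype.equivOfCardEq (Fintype.card_fin _) ⟨j, by omega⟩, by
          rw [Matrix.IsHermitian.eigenvalues, Equiv.symm_apply_apply]
          exact (hpos.trans_le (hM.1.eigenvalues₀_antitone
            (Fin.mk_le_mk.2 (Nat.lt_succ_iff.1 j.2)))).ne'⟩
      have hf : Function.Injective f := by
        intro a b hab
        have := (Fintype.equivOfCardEq (Fintype.card_fin _)).injective (Subtype.mk.inj hab)
        exact Fin.ext (Fin.mk.inj this)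
      simpa using Fintype.card_le_of_injective f hf
    omega
  · rw [sortedEigenvalue, dif_neg (fun h' => h h'.2)]

/-- The eigenvectors for the sorted eigenvalues. -/
noncomputable def sortedEigenbasis {Z : Type} [Fintype Z] [DecidableEq Z] {M : Matrix Z Z ℂ}
    (hM : M.IsHermitian) : OrthonormalBasis (Fin (Fintype.card Z)) ℂ (EuclideanSpace ℂ Z) :=
  hM.eigenvectorBasis.reindex (Fintype.equivOfCardEq (Fintype.card_fin _)).symm

theorem eq_sum_sortedEigenvalue_smul_ketBra {Z : Type} [Fintype Z] [DecidableEq Z]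
    {M : Matrix Z Z ℂ} (hM : M.IsHermitian) :
    M = ∑ i : Fin (Fintype.card Z),
      sortedEigenvalue M i • ketBra (fun z => sortedEigenbasis hM i z) := by
  have h1 : M = ∑ z, hM.eigenvalues z • ketBra (fun a => hM.eigenvectorBasis z a) := by
    ext i j
    conv_lhs => rw [hM.spectral_theorem, Unitary.conjStarAlgAut_apply]
    rw [Matrix.mul_apply]
    simp only [Matrix.mul_diagonal, Matrix.sum_apply, Matrix.smul_apply, ketBra,
      Matrix.vecMulVec_apply, Matrix.star_apply, Pi.star_apply, Complex.real_smul,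
      Function.comp_apply, Matrix.IsHermitian.eigenvectorUnitary_apply]
    refine Finset.sum_congr rfl fun z _ => ?_
    simp
    ring
  conv_lhs => rw [h1]
  rw [← (Fintype.equivOfCardEq (Fintype.card_fin (Fintype.card Z))).sum_comp]
  refine Finset.sum_congr rfl fun i _ => ?_
  rw [sortedEigenvalue, dif_pos ⟨hM, i.2⟩, Matrix.IsHermitian.eigenvalues,
    Equiv.symm_apply_apply, sortedEigenbasis]
  simp

theorem star_dotProduct_orthonormalBasis {ι Z : Type} [Fintype ι] [DecidableEq ι] [Fintype Z]
    (b : OrthonormalBasis ι ℂ (EuclideanSpace ℂ Z)) (i j : ι) :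
    star (fun a => b i a) ⬝ᵥ (fun a => b j a) = if i = j then 1 else 0 := by
  rw [← orthonormal_iff_ite.1 b.orthonormal i j, EuclideanSpace.inner_eq_star_dotProduct,
    dotProduct_comm]

/-! ## The function `G` in terms of partial isometries -/

theorem partialIsometry_rank_le {X Z : Type} [Fintype X] [Fintype Z] {σ : Matrix Z Z ℂ}
    {V : Matrix X Z ℂ} (hV : Vᴴ * V * σ = σ) : σ.rank ≤ Fintype.card X := by
  classical
  rw [← hV, Matrix.mul_assoc]
  exact (Matrix.rank_mul_le_left _ _).trans (by
    simpa using Matrix.rank_le_card_width (Vᴴ))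

/-- Take `V = ∑ |b_i⟩⟨e_i|` with `e_i` the sorted eigenvectors of `σ`. The rank bound ensures that
the eigenvectors used span the support of `σ`. -/
theorem exists_partialIsometry_of_orthonormalBasis {X Z : Type} [Fintype X] [Fintype Z]
    [DecidableEq Z] {σ : Matrix Z Z ℂ} (hσ : σ.PosSemidef) (hr : σ.rank ≤ Fintype.card X)
    (b : OrthonormalBasis (Fin (Fintype.card X)) ℂ (EuclideanSpace ℂ X)) :
    ∃ V : Matrix X Z ℂ, Vᴴ * V * σ = σ ∧
      V * σ * Vᴴ = ∑ i : Fin (Fintype.card X), sortedEigenvalue σ i • ketBra (fun a => b i a) := by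
  classical
  -- Indices beyond the dimension of `ℂ^Z` get the zero vector, so that neither dimension need be
  -- the larger one.
  let e : ℕ → Z → ℂ := fun i =>
    if h : i < Fintype.card Z then fun z => sortedEigenbasis hσ.1 ⟨i, h⟩ z else 0
  let β : Fin (Fintype.card X) → X → ℂ := fun i a => b i a
  have hsum : σ = ∑ i : Fin (Fintype.card X), sortedEigenvalue σ i • ketBra (e i) := by
    rw [← Finset.sum_range (fun i => sortedEigenvalue σ i • ketBra (e i))]
    have h1 : ∑ i ∈ Finset.range (Fintype.card Z), sortedEigenvalue σ i • ketBra (e i) = σ := by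
      conv_rhs => rw [eq_sum_sortedEigenvalue_smul_ketBra hσ.1]
      rw [Finset.sum_range]
      refine Finset.sum_congr rfl fun i _ => ?_
      simp [e]
    conv_lhs => rw [← h1]
    -- Both the sum up to `card Z` and the sum up to `card X` truncate at the rank of `σ`, hence
    -- agree.
    have h2 : ∀ n, σ.rank ≤ n → ∑ i ∈ Finset.range n, sortedEigenvalue σ i • ketBra (e i) =
        ∑ i ∈ Finset.range σ.rank, sortedEigenvalue σ i • ketBra (e i) := by
      intro n hn
      symm
      refine Finset.sum_subset (Finset.range_mono hn) fun i _ hi => ?_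
      rw [sortedEigenvalue_eq_zero hσ (by simpa using hi), zero_smul]
    rw [h2 _ hr, h2 _ (Matrix.rank_le_card_width σ)]
  have he : ∀ i j : Fin (Fintype.card X), star (e i) ⬝ᵥ e j =
      if i = j ∧ (i : ℕ) < Fintype.card Z then 1 else 0 := by
    intro i j
    by_cases hi : (i : ℕ) < Fintype.card Z
    · by_cases hj : (j : ℕ) < Fintype.card Z
      · simp only [e, dif_pos hi, dif_pos hj]
        rw [star_dotProduct_orthonormalBasis]
        simp [hi, Fin.ext_iff]
      · have : i ≠ j := by rintro rfl; exact hj hi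
        simp [e, hj, this]
    · simp [e, hi]
  let V : Matrix X Z ℂ := ∑ i, Matrix.vecMulVec (β i) (star (e i))
  have hVe : ∀ j : Fin (Fintype.card X), V *ᵥ e j =
      if (j : ℕ) < Fintype.card Z then β j else 0 := by
    intro j
    simp only [V, Matrix.sum_mulVec, Matrix.vecMulVec_mulVec, he]
    rw [Finset.sum_eq_single j]
    · by_cases hj : (j : ℕ) < Fintype.card Z <;> simp [hj]
    · intro i _ hij
      simp [hij]
    · simp
  have hVb : ∀ j : Fin (Fintype.card X), Vᴴ *ᵥ β j = e j := by
    intro j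
    simp only [V, Matrix.conjTranspose_sum, Matrix.conjTranspose_vecMulVec, star_star,
      Matrix.sum_mulVec, Matrix.vecMulVec_mulVec, β, star_dotProduct_orthonormalBasis]
    rw [Finset.sum_eq_single j]
    · simp
    · intro i _ hij
      simp [hij]
    · simp
  refine ⟨V, ?_, ?_⟩
  · conv_rhs => rw [hsum]
    conv_lhs => rw [hsum]
    rw [Matrix.mul_sum]
    refine Finset.sum_congr rfl fun j _ => ?_
    rw [Matrix.mul_smul, ketBra, Matrix.mul_vecMulVec, ← Matrix.mulVec_mulVec, hVe]
    by_cases hj : (j : ℕ) < Fintype.card Z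
    · rw [if_pos hj, hVb]
    · rw [if_neg hj, show e j = 0 by simp [e, hj]]
      simp
  · conv_lhs => rw [hsum]
    rw [Matrix.mul_sum, Matrix.sum_mul]
    refine Finset.sum_congr rfl fun j _ => ?_
    rw [Matrix.mul_smul, Matrix.smul_mul, mul_ketBra_mul_conjTranspose, hVe]
    by_cases hj : (j : ℕ) < Fintype.card Z
    · rw [if_pos hj]
    · rw [sortedEigenvalue, dif_neg (fun h => hj h.2), zero_smul, zero_smul]

/-- With `σ = B B†`, the condition on `V` gives `V† V B = B`, so `(V B)† (V B) = B† B`; exchanging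
the factors preserves the nonzero spectrum. -/
theorem sortedEigenvalue_partialIsometry {X Z : Type} [Fintype X] [DecidableEq X] [Fintype Z]
    [DecidableEq Z] {σ : Matrix Z Z ℂ} (hσ : σ.PosSemidef) {V : Matrix X Z ℂ}
    (hV : Vᴴ * V * σ = σ) : sortedEigenvalue (V * σ * Vᴴ) = sortedEigenvalue σ := by
  obtain ⟨B, rfl⟩ := exists_eq_mul_conjTranspose hσ
  have h0 : (Vᴴ * V - 1) * B = 0 := by
    rw [← Matrix.mul_self_mul_conjTranspose_eq_zero, Matrix.sub_mul, Matrix.one_mul, hV, sub_self]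
  have h1 : Vᴴ * V * B = B := by
    rwa [Matrix.sub_mul, Matrix.one_mul, sub_eq_zero] at h0
  have h2 : V * (B * Bᴴ) * Vᴴ = (V * B) * (V * B)ᴴ := by
    simp only [Matrix.conjTranspose_mul, Matrix.mul_assoc]
  rw [h2, sortedEigenvalue_mul_conjTranspose, sortedEigenvalue_mul_conjTranspose,
    Matrix.conjTranspose_mul, Matrix.mul_assoc, ← Matrix.mul_assoc Vᴴ, h1]

/-- A basis yields a `V`; conversely an eigenbasis of `V σ V†` yields the basis, because `V`
preserves the sorted eigenvalues. -/
theorem spectralSup_eq_sSup_partialIsometry {X Z : Type} [Fintype X] [Fintype Z] [DecidableEq Z]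
    (R : Matrix X X ℂ → ℝ) {σ : Matrix Z Z ℂ} (hσ : σ.PosSemidef) :
    spectralSup R σ =
      sSup {x | ∃ V : Matrix X Z ℂ, Vᴴ * V * σ = σ ∧ x = R (V * σ * Vᴴ)} := by
  classical
  rw [spectralSup]
  split_ifs with hr
  · congr 1
    ext x
    constructor
    · rintro ⟨b, rfl⟩
      obtain ⟨V, h1, h2⟩ := exists_partialIsometry_of_orthonormalBasis hσ hr b
      exact ⟨V, h1, by rw [h2]⟩
    · rintro ⟨V, h1, rfl⟩
      have hH := (hσ.mul_mul_conjTranspose_same V).1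
      refine ⟨sortedEigenbasis hH, ?_⟩
      rw [← sortedEigenvalue_partialIsometry hσ h1, ← eq_sum_sortedEigenvalue_smul_ketBra hH]
  -- If the rank is too large, no `V` exists, and the convention `sSup ∅ = 0` matches the value `0`
  -- of `G`.
  · symm
    convert Real.sSup_empty
    ext x
    simp only [Set.mem_ofPred_eq, Set.mem_empty_iff_false, iff_false]
    rintro ⟨V, h1, -⟩
    exact hr (partialIsometry_rank_le h1)

/-! ## Homogeneous extension of functions of states -/

theorem convex_densityMatrices (X : Type) [Fintype X] : Convex ℝ (densityMatrices X) := by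
  intro ρ hρ σ hσ a b ha hb hab
  refine ⟨(hρ.1.smul ha).add (hσ.1.smul hb), ?_⟩
  rw [Matrix.trace_add, Matrix.trace_smul, Matrix.trace_smul, hρ.2, hσ.2, ← add_smul, hab, one_smul]

theorem trace_re_nonneg {X : Type} [Fintype X] {σ : Matrix X X ℂ} (h : σ.PosSemidef) :
    0 ≤ σ.trace.re :=
  (Complex.nonneg_iff.1 h.trace_nonneg).1

theorem ofReal_trace_re {X : Type} [Fintype X] {σ : Matrix X X ℂ} (h : σ.PosSemidef) :
    ((σ.trace.re : ℝ) : ℂ) = σ.trace :=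
  Complex.ext rfl (Complex.nonneg_iff.1 h.trace_nonneg).2

theorem eq_zero_of_trace_re_eq_zero {X : Type} [Fintype X] {σ : Matrix X X ℂ} (h : σ.PosSemidef)
    (h0 : σ.trace.re = 0) : σ = 0 :=
  h.trace_eq_zero_iff.1 (by rw [← ofReal_trace_re h, h0, Complex.ofReal_zero])

theorem inv_trace_smul_mem_densityMatrices {X : Type} [Fintype X] {σ : Matrix X X ℂ}
    (h : σ.PosSemidef) (h0 : σ.trace.re ≠ 0) : σ.trace.re⁻¹ • σ ∈ densityMatrices X := by
  refine ⟨h.smul (inv_nonneg.2 (trace_re_nonneg h)), ?_⟩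
  rw [Matrix.trace_smul, ← ofReal_trace_re h, Complex.real_smul, Complex.ofReal_re,
    ← Complex.ofReal_mul, inv_mul_cancel₀ h0, Complex.ofReal_one]

theorem isUnitVector_normalize {X : Type} [Fintype X] {ψ : X → ℂ} {t : ℝ}
    (ht : t = ∑ x, ‖ψ x‖ ^ 2) (h0 : t ≠ 0) :
    IsUnitVector (((√t)⁻¹ : ℂ) • ψ) := by
  have h1 : 0 ≤ t := ht ▸ Finset.sum_nonneg fun x _ => sq_nonneg _
  simp only [IsUnitVector, Pi.smul_apply, norm_smul, mul_pow, norm_inv, Complex.norm_real, inv_pow,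
    Real.norm_eq_abs, sq_abs, Real.sq_sqrt h1]
  rw [← Finset.mul_sum, ← ht, inv_mul_cancel₀ h0]

/-- The positively homogeneous extension of a function of states to positive operators. -/
noncomputable def homExt {X : Type} [Fintype X] (g : Matrix X X ℂ → ℝ) (σ : Matrix X X ℂ) : ℝ :=
  σ.trace.re * g (σ.trace.re⁻¹ • σ)

theorem homExt_zero {X : Type} [Fintype X] (g : Matrix X X ℂ → ℝ) : homExt g 0 = 0 := by
  simp [homExt]

theorem homExt_of_mem {X : Type} [Fintype X] (g : Matrix X X ℂ → ℝ) {σ : Matrix X X ℂ}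
    (h : σ ∈ densityMatrices X) : homExt g σ = g σ := by
  simp [homExt, h.2]

/-- No sign condition on `c` is needed: the factor cancels in the normalised argument. -/
theorem homExt_smul {X : Type} [Fintype X] (g : Matrix X X ℂ → ℝ) (c : ℝ) (σ : Matrix X X ℂ) :
    homExt g (c • σ) = c * homExt g σ := by
  rcases eq_or_ne c 0 with rfl | hc
  · simp [homExt_zero]
  · have h : (c • σ).trace.re = c * σ.trace.re := by
      rw [Matrix.trace_smul, Complex.smul_re, smul_eq_mul]
    rw [homExt, homExt, h, smul_smul, mul_inv, mul_assoc, mul_right_comm c⁻¹, inv_mul_cancel₀ hc,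
      one_mul]

theorem homExt_nonneg {X : Type} [Fintype X] {g : Matrix X X ℂ → ℝ}
    (hg : ∀ σ ∈ densityMatrices X, 0 ≤ g σ) {σ : Matrix X X ℂ} (h : σ.PosSemidef) :
    0 ≤ homExt g σ := by
  rcases eq_or_ne σ.trace.re 0 with h0 | h0
  · simp [homExt, h0]
  · exact mul_nonneg (trace_re_nonneg h) (hg _ (inv_trace_smul_mem_densityMatrices h h0))

theorem homExt_mono {X : Type} [Fintype X] {f g : Matrix X X ℂ → ℝ}
    (hfg : ∀ σ ∈ densityMatrices X, f σ ≤ g σ) {σ : Matrix X X ℂ} (h : σ.PosSemidef) :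
    homExt f σ ≤ homExt g σ := by
  rcases eq_or_ne σ.trace.re 0 with h0 | h0
  · simp [homExt, h0]
  · exact mul_le_mul_of_nonneg_left (hfg _ (inv_trace_smul_mem_densityMatrices h h0))
      (trace_re_nonneg h)

/-- Convexity is applied to the normalised operators with weights proportional to their traces.
Operators of trace zero vanish and are treated apart. -/
theorem homExt_add_le {X : Type} [Fintype X] {g : Matrix X X ℂ → ℝ}
    (hg : ConvexOn ℝ (densityMatrices X) g) {σ τ : Matrix X X ℂ} (hσ : σ.PosSemidef)
    (hτ : τ.PosSemidef) : homExt g (σ + τ) ≤ homExt g σ + homExt g τ := by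
  rcases eq_or_ne σ.trace.re 0 with h0 | h0
  · rw [eq_zero_of_trace_re_eq_zero hσ h0, zero_add, homExt_zero, zero_add]
  rcases eq_or_ne τ.trace.re 0 with h1 | h1
  · rw [eq_zero_of_trace_re_eq_zero hτ h1, add_zero, homExt_zero, add_zero]
  have p0 : 0 < σ.trace.re := lt_of_le_of_ne (trace_re_nonneg hσ) h0.symm
  have p1 : 0 < τ.trace.re := lt_of_le_of_ne (trace_re_nonneg hτ) h1.symm
  have ht : (σ + τ).trace.re = σ.trace.re + τ.trace.re := by
    rw [Matrix.trace_add, Complex.add_re]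
  have h := hg.2 (inv_trace_smul_mem_densityMatrices hσ h0)
    (inv_trace_smul_mem_densityMatrices hτ h1)
    (by positivity : 0 ≤ σ.trace.re / (σ.trace.re + τ.trace.re))
    (by positivity : 0 ≤ τ.trace.re / (σ.trace.re + τ.trace.re))
    (by rw [← add_div, div_self (by positivity)])
  have e : ∀ {t s : ℝ}, t ≠ 0 → t / s * t⁻¹ = s⁻¹ := fun h => by field_simp
  rw [smul_smul, smul_smul, e h0, e h1, ← smul_add, smul_eq_mul, smul_eq_mul] at h
  rw [homExt, homExt, homExt, ht]
  refine (mul_le_mul_of_nonneg_left h (add_pos p0 p1).le).trans (le_of_eq ?_)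
  field_simp

theorem homExt_sum_le {X ι : Type} [Fintype X] {g : Matrix X X ℂ → ℝ}
    (hg : ConvexOn ℝ (densityMatrices X) g) (s : Finset ι) {σ : ι → Matrix X X ℂ}
    (hσ : ∀ k, (σ k).PosSemidef) : homExt g (∑ k ∈ s, σ k) ≤ ∑ k ∈ s, homExt g (σ k) := by
  classical
  induction s using Finset.induction_on with
  | empty => simp [homExt_zero]
  | insert a s ha ih =>
    rw [Finset.sum_insert ha, Finset.sum_insert ha]
    exact (homExt_add_le hg (hσ a) (Matrix.posSemidef_sum s fun k _ => hσ k)).trans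
      (by gcongr)

theorem sum_homExt_le {X ι : Type} [Fintype X] {g : Matrix X X ℂ → ℝ}
    (hg : ConcaveOn ℝ (densityMatrices X) g) (s : Finset ι) {σ : ι → Matrix X X ℂ}
    (hσ : ∀ k, (σ k).PosSemidef) : ∑ k ∈ s, homExt g (σ k) ≤ homExt g (∑ k ∈ s, σ k) := by
  have h := homExt_sum_le hg.neg s hσ
  simpa [homExt] using h

/-! ## Properties of `G` and of the entropy -/

theorem exists_isUnitVector (X : Type) [Fintype X] [Nonempty X] :
    ∃ ψ : X → ℂ, IsUnitVector ψ := by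
  classical
  obtain ⟨x⟩ := ‹Nonempty X›
  refine ⟨Pi.single x 1, ?_⟩
  rw [IsUnitVector, Finset.sum_eq_single x] <;> simp +contextual

theorem isLUB_stateSup {X : Type} [Fintype X] [Nonempty X] {R : Matrix X X ℂ → ℝ}
    (hb : BddAbove (R '' densityMatrices X)) : IsLUB (R '' densityMatrices X) (stateSup R) := by
  obtain ⟨ψ, hψ⟩ := exists_isUnitVector X
  exact isLUB_csSup ⟨_, Set.mem_image_of_mem R (ketBra_mem_densityMatrices hψ)⟩ hb

theorem le_stateSup {X : Type} [Fintype X] {R : Matrix X X ℂ → ℝ}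
    (hb : BddAbove (R '' densityMatrices X)) {σ : Matrix X X ℂ} (hσ : σ ∈ densityMatrices X) :
    R σ ≤ stateSup R :=
  le_csSup hb (Set.mem_image_of_mem R hσ)

theorem partialIsometry_mem_densityMatrices {X Z : Type} [Fintype X] [Fintype Z]
    {σ : Matrix Z Z ℂ} (hσ : σ ∈ densityMatrices Z) {V : Matrix X Z ℂ} (hV : Vᴴ * V * σ = σ) :
    V * σ * Vᴴ ∈ densityMatrices X := by
  refine ⟨hσ.1.mul_mul_conjTranspose_same V, ?_⟩
  rw [Matrix.trace_mul_comm, ← Matrix.mul_assoc, hV, hσ.2]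

/-- The support of `σ` lies in that of `σ + τ`. With `P = V† V - 1`, the traces of `P σ P†` and `P τ
P†` are non-negative with sum zero, so both vanish. -/
theorem partialIsometry_mul_of_add {X Z : Type} [Fintype X] [Fintype Z] {σ τ : Matrix Z Z ℂ}
    (hσ : σ.PosSemidef) (hτ : τ.PosSemidef) {V : Matrix X Z ℂ}
    (hV : Vᴴ * V * (σ + τ) = σ + τ) : Vᴴ * V * σ = σ := by
  classical
  obtain ⟨B, rfl⟩ := exists_eq_mul_conjTranspose hσ
  set P := Vᴴ * V - 1 with hP
  have h1 : P * (B * Bᴴ + τ) = 0 := by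
    rw [hP, Matrix.sub_mul, Matrix.one_mul, hV, sub_self]
  have h2 : (P * B) * (P * B)ᴴ + P * τ * Pᴴ = 0 := by
    rw [← Matrix.zero_mul Pᴴ, ← h1]
    simp only [Matrix.conjTranspose_mul, Matrix.mul_assoc, Matrix.mul_add, Matrix.add_mul]
  have h3 := congrArg Matrix.trace h2
  rw [Matrix.trace_add, Matrix.trace_zero] at h3
  have h4 := (add_eq_zero_iff_of_nonneg
    (Matrix.posSemidef_self_mul_conjTranspose (P * B)).trace_nonneg
    (hτ.mul_mul_conjTranspose_same P).trace_nonneg).1 h3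
  have h5 : P * B = 0 := Matrix.trace_mul_conjTranspose_self_eq_zero_iff.1 h4.1
  have h6 : P * (B * Bᴴ) = 0 := by rw [← Matrix.mul_assoc, h5, Matrix.zero_mul]
  rwa [hP, Matrix.sub_mul, Matrix.one_mul, sub_eq_zero] at h6

section

variable {X : Type} [Fintype X] {R : Matrix X X ℂ → ℝ}
  {Z : Type} [Fintype Z] [DecidableEq Z]

theorem le_spectralSup (hb : BddAbove (R '' densityMatrices X)) {σ : Matrix Z Z ℂ}
    (hσ : σ ∈ densityMatrices Z) {V : Matrix X Z ℂ} (hV : Vᴴ * V * σ = σ) :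
    R (V * σ * Vᴴ) ≤ spectralSup R σ := by
  rw [spectralSup_eq_sSup_partialIsometry R hσ.1]
  refine le_csSup ?_ ⟨V, hV, rfl⟩
  refine hb.mono ?_
  rintro _ ⟨V, hV, rfl⟩
  exact Set.mem_image_of_mem R (partialIsometry_mem_densityMatrices hσ hV)

theorem spectralSup_nonneg (hn : ∀ σ ∈ densityMatrices X, 0 ≤ R σ) {σ : Matrix Z Z ℂ}
    (hσ : σ ∈ densityMatrices Z) : 0 ≤ spectralSup R σ := by
  rw [spectralSup_eq_sSup_partialIsometry R hσ.1]
  refine Real.sSup_nonneg ?_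
  rintro _ ⟨V, hV, rfl⟩
  exact hn _ (partialIsometry_mem_densityMatrices hσ hV)

theorem spectralSup_le_stateSup (hn : ∀ σ ∈ densityMatrices X, 0 ≤ R σ)
    (hb : BddAbove (R '' densityMatrices X)) {σ : Matrix Z Z ℂ}
    (hσ : σ ∈ densityMatrices Z) : spectralSup R σ ≤ stateSup R := by
  rw [spectralSup_eq_sSup_partialIsometry R hσ.1]
  refine Real.sSup_le ?_ (Real.sSup_nonneg ?_)
  · rintro _ ⟨V, hV, rfl⟩
    exact le_stateSup hb (partialIsometry_mem_densityMatrices hσ hV)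
  · rintro _ ⟨σ, hσ, rfl⟩
    exact hn σ hσ

theorem le_spectralSup_self [DecidableEq X] (hb : BddAbove (R '' densityMatrices X))
    {σ : Matrix X X ℂ} (hσ : σ ∈ densityMatrices X) : R σ ≤ spectralSup R σ := by
  have h := le_spectralSup hb hσ (V := (1 : Matrix X X ℂ)) (by simp)
  simpa using h

theorem convexOn_spectralSup (hR : ConvexOn ℝ (densityMatrices X) R)
    (hn : ∀ σ ∈ densityMatrices X, 0 ≤ R σ) (hb : BddAbove (R '' densityMatrices X)) :
    ConvexOn ℝ (densityMatrices Z) (spectralSup R) := by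
  -- Strictly positive weights suffice, and are cancelled below to pass from `a • σ` to `σ`.
  refine convexOn_iff_forall_pos.2 ⟨convex_densityMatrices Z, ?_⟩
  intro σ hσ τ hτ a b ha hb' hab
  have hmem := convex_densityMatrices Z hσ hτ ha.le hb'.le hab
  rw [spectralSup_eq_sSup_partialIsometry R hmem.1]
  -- Non-negativity of the right side covers the case where no `V` exists for the mixture and its
  -- `G` is `0`.
  refine Real.sSup_le ?_ (add_nonneg (smul_nonneg ha.le (spectralSup_nonneg hn hσ))
    (smul_nonneg hb'.le (spectralSup_nonneg hn hτ)))
  rintro _ ⟨V, hV, rfl⟩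
  have cancel : ∀ {c : ℝ} {ω : Matrix Z Z ℂ}, c ≠ 0 → Vᴴ * V * (c • ω) = c • ω →
      Vᴴ * V * ω = ω := by
    intro c ω hc h
    rw [Matrix.mul_smul] at h
    exact smul_right_injective _ hc h
  have hVσ := cancel ha.ne' (partialIsometry_mul_of_add (hσ.1.smul ha.le) (hτ.1.smul hb'.le) hV)
  have hVτ := cancel hb'.ne' (partialIsometry_mul_of_add (hτ.1.smul hb'.le) (hσ.1.smul ha.le)
    (by rwa [add_comm]))
  rw [Matrix.mul_add, Matrix.add_mul, Matrix.mul_smul, Matrix.mul_smul, Matrix.smul_mul,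
    Matrix.smul_mul]
  refine (hR.2 (partialIsometry_mem_densityMatrices hσ hVσ)
    (partialIsometry_mem_densityMatrices hτ hVτ) ha.le hb'.le hab).trans ?_
  exact add_le_add (smul_le_smul_of_nonneg_left (le_spectralSup hb hσ hVσ) ha.le)
    (smul_le_smul_of_nonneg_left (le_spectralSup hb hτ hVτ) hb'.le)

/-- The operator `V = |φ⟩⟨ψ|` carries `ψ` to any chosen pure state of A. -/
theorem le_spectralSup_ketBra_of_isUnitVector (hb : BddAbove (R '' densityMatrices X)) {ψ : Z → ℂ}
    (hψ : IsUnitVector ψ) {φ : X → ℂ} (hφ : IsUnitVector φ) :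
    R (ketBra φ) ≤ spectralSup R (ketBra ψ) := by
  have hV : Matrix.vecMulVec φ (star ψ) *ᵥ ψ = φ := by
    rw [Matrix.vecMulVec_mulVec, star_dotProduct_self_of_isUnitVector hψ]
    simp
  have h := le_spectralSup hb (ketBra_mem_densityMatrices hψ)
    (V := Matrix.vecMulVec φ (star ψ)) (by
      rw [ketBra, Matrix.mul_vecMulVec, ← Matrix.mulVec_mulVec, hV,
        Matrix.conjTranspose_vecMulVec, star_star, Matrix.vecMulVec_mulVec,
        star_dotProduct_self_of_isUnitVector hφ]
      simp)
  rwa [mul_ketBra_mul_conjTranspose, hV] at h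

/-- Any state of A is a mixture of pure states; convexity bounds `R` there by the average of its
values at pure states, each at most `G(|ψ⟩⟨ψ|)`. -/
theorem spectralSup_ketBra (hR : ConvexOn ℝ (densityMatrices X) R)
    (hn : ∀ σ ∈ densityMatrices X, 0 ≤ R σ) (hb : BddAbove (R '' densityMatrices X)) {ψ : Z → ℂ}
    (hψ : IsUnitVector ψ) : spectralSup R (ketBra ψ) = stateSup R := by
  have hψ' := ketBra_mem_densityMatrices hψ
  refine le_antisymm (spectralSup_le_stateSup hn hb hψ') (Real.sSup_le ?_
    (spectralSup_nonneg hn hψ'))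
  rintro _ ⟨σ, hσ, rfl⟩
  obtain ⟨B, hB⟩ := exists_eq_mul_conjTranspose hσ.1
  rw [mul_conjTranspose_eq_sum_ketBra] at hB
  have htr : ∑ k, (ketBra fun x => B x k).trace.re = 1 := by
    rw [← Complex.re_sum, ← Matrix.trace_sum, hB, hσ.2, Complex.one_re]
  calc R σ = homExt R (∑ k, ketBra fun x => B x k) := by rw [hB, homExt_of_mem R hσ]
    _ ≤ ∑ k, homExt R (ketBra fun x => B x k) :=
      homExt_sum_le hR _ fun k => ketBra_posSemidef _
    _ ≤ ∑ k, (ketBra fun x => B x k).trace.re * spectralSup R (ketBra ψ) := by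
      refine Finset.sum_le_sum fun k _ => ?_
      rw [homExt]
      rcases eq_or_ne (ketBra fun x => B x k).trace.re 0 with h0 | h0
      · simp [h0]
      refine mul_le_mul_of_nonneg_left ?_ (trace_re_nonneg (ketBra_posSemidef _))
      have ht : (ketBra fun x => B x k).trace.re = ∑ x, ‖B x k‖ ^ 2 := by
        rw [trace_ketBra, Complex.ofReal_re]
      have h1 := le_spectralSup_ketBra_of_isUnitVector hb hψ (isUnitVector_normalize ht h0)
      rw [ketBra_smul] at h1
      simpa [Real.sq_sqrt (trace_re_nonneg (ketBra_posSemidef fun x => B x k))] using h1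
    _ = spectralSup R (ketBra ψ) := by rw [← Finset.sum_mul, htr, one_mul]

theorem resourceEntropy_nonneg (hn : ∀ σ ∈ densityMatrices X, 0 ≤ R σ)
    (hb : BddAbove (R '' densityMatrices X)) {σ : Matrix Z Z ℂ}
    (hσ : σ ∈ densityMatrices Z) : 0 ≤ resourceEntropy R σ :=
  sub_nonneg.2 (spectralSup_le_stateSup hn hb hσ)

theorem concaveOn_resourceEntropy (hR : ConvexOn ℝ (densityMatrices X) R)
    (hn : ∀ σ ∈ densityMatrices X, 0 ≤ R σ) (hb : BddAbove (R '' densityMatrices X)) :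
    ConcaveOn ℝ (densityMatrices Z) (resourceEntropy R) :=
  (concaveOn_const _ (convex_densityMatrices Z)).sub (convexOn_spectralSup hR hn hb)

theorem homExt_resourceEntropy_ketBra (hR : ConvexOn ℝ (densityMatrices X) R)
    (hn : ∀ σ ∈ densityMatrices X, 0 ≤ R σ) (hb : BddAbove (R '' densityMatrices X)) (ψ : Z → ℂ) :
    homExt (resourceEntropy R) (ketBra ψ) = 0 := by
  rw [homExt]
  rcases eq_or_ne (ketBra ψ).trace.re 0 with h0 | h0
  · simp [h0]
  have ht : (ketBra ψ).trace.re = ∑ x, ‖ψ x‖ ^ 2 := by rw [trace_ketBra, Complex.ofReal_re]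
  have h1 := spectralSup_ketBra hR hn hb (isUnitVector_normalize ht h0)
  rw [ketBra_smul] at h1
  have h2 : (‖((√(ketBra ψ).trace.re)⁻¹ : ℂ)‖ ^ 2 : ℝ) = (ketBra ψ).trace.re⁻¹ := by
    simp [Real.sq_sqrt (trace_re_nonneg (ketBra_posSemidef ψ))]
  rw [h2] at h1
  rw [resourceEntropy, h1, sub_self, mul_zero]

/-- For a pure state with coefficient matrix `Q`, the two sides refer to the reduced states of the
two parties, which share rank and nonzero spectrum. -/
theorem spectralSup_mul_conjTranspose (R : Matrix X X ℂ → ℝ) {W : Type} [Fintype W]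
    [DecidableEq W] (Q : Matrix Z W ℂ) :
    spectralSup R (Q * Qᴴ) = spectralSup R (Qᴴ * Q)ᵀ := by
  rw [spectralSup, spectralSup, Matrix.rank_transpose, Matrix.rank_conjTranspose_mul_self,
    Matrix.rank_self_mul_conjTranspose,
    sortedEigenvalue_transpose (Matrix.posSemidef_conjTranspose_mul_self Q),
    sortedEigenvalue_mul_conjTranspose]

theorem homExt_resourceEntropy_mul_conjTranspose (R : Matrix X X ℂ → ℝ) {W : Type} [Fintype W]
    [DecidableEq W] (Q : Matrix Z W ℂ) :
    homExt (resourceEntropy R) (Q * Qᴴ) = homExt (resourceEntropy R) (Qᴴ * Q)ᵀ := by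
  have ht : (Qᴴ * Q)ᵀ.trace = (Q * Qᴴ).trace := by
    rw [Matrix.trace_transpose, Matrix.trace_mul_comm]
  have hnn := trace_re_nonneg (Matrix.posSemidef_self_mul_conjTranspose Q)
  rw [homExt, homExt, ht, resourceEntropy, resourceEntropy]
  set t := (Q * Qᴴ).trace.re
  -- The normalisation is absorbed into `Q` so that the unnormalised symmetry applies.
  have h1 : t⁻¹ • (Q * Qᴴ) = ((√t)⁻¹ • Q) * ((√t)⁻¹ • Q)ᴴ := by
    rw [Matrix.conjTranspose_smul, Matrix.smul_mul, Matrix.mul_smul, smul_smul, star_trivial,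
      ← mul_inv, Real.mul_self_sqrt hnn]
  have h2 : t⁻¹ • (Qᴴ * Q)ᵀ = (((√t)⁻¹ • Q)ᴴ * ((√t)⁻¹ • Q))ᵀ := by
    rw [Matrix.conjTranspose_smul, Matrix.smul_mul, Matrix.mul_smul, smul_smul, star_trivial,
      ← mul_inv, Real.mul_self_sqrt hnn, Matrix.transpose_smul]
  rw [h1, h2, spectralSup_mul_conjTranspose]

end

/-! ## Pure bipartite states -/

/-- The matrix of coefficients of a vector of `ℂ^X ⊗ ℂ^Y`. -/
def coeffMatrix {X Y : Type} (φ : X × Y → ℂ) : Matrix X Y ℂ :=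
  Matrix.of fun x y => φ (x, y)

theorem partialTraceB_ketBra {X Y : Type} [Fintype Y] (φ : X × Y → ℂ) :
    partialTraceB (ketBra φ) = coeffMatrix φ * (coeffMatrix φ)ᴴ := by
  ext i j
  simp [partialTraceB, ketBra, coeffMatrix, Matrix.mul_apply, Matrix.vecMulVec_apply]

theorem coeffMatrix_kronecker_mulVec {X Y X' Y' : Type} [Fintype X] [Fintype Y]
    (M : Matrix X' X ℂ) (N : Matrix Y' Y ℂ) (φ : X × Y → ℂ) :
    coeffMatrix ((M ⊗ₖ N) *ᵥ φ) = M * coeffMatrix φ * Nᵀ := by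
  ext i j
  simp only [coeffMatrix, Matrix.of_apply, Matrix.mulVec, dotProduct, Matrix.mul_apply,
    Matrix.kroneckerMap_apply, Matrix.transpose_apply, Fintype.sum_prod_type, Finset.sum_mul]
  rw [Finset.sum_comm]
  refine Finset.sum_congr rfl fun y _ => Finset.sum_congr rfl fun x _ => ?_
  ring

theorem partialTraceB_sum {X Y ι : Type} [Fintype Y] (s : Finset ι)
    (ρ : ι → Matrix (X × Y) (X × Y) ℂ) :
    partialTraceB (∑ k ∈ s, ρ k) = ∑ k ∈ s, partialTraceB (ρ k) := by
  ext i j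
  simp only [partialTraceB, Matrix.of_apply, Matrix.sum_apply]
  exact Finset.sum_comm

theorem partialTraceB_smul {X Y : Type} [Fintype Y] (c : ℝ) (ρ : Matrix (X × Y) (X × Y) ℂ) :
    partialTraceB (c • ρ) = c • partialTraceB ρ := by
  ext i j
  simp [partialTraceB, Finset.mul_sum]

theorem partialTraceB_ketBra_posSemidef {X Y : Type} [Fintype X] [Fintype Y] (φ : X × Y → ℂ) :
    (partialTraceB (ketBra φ)).PosSemidef := by
  rw [partialTraceB_ketBra]
  exact Matrix.posSemidef_self_mul_conjTranspose _

theorem trace_partialTraceB {X Y : Type} [Fintype X] [Fintype Y] (ρ : Matrix (X × Y) (X × Y) ℂ) :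
    (partialTraceB ρ).trace = ρ.trace := by
  simp [Matrix.trace, partialTraceB, Fintype.sum_prod_type]

theorem exists_eq_sum_ketBra {Z : Type} [Fintype Z] {σ : Matrix Z Z ℂ} (h : σ.PosSemidef) :
    ∃ φ : Z → Z → ℂ, ∑ k, ketBra (φ k) = σ := by
  obtain ⟨B, hB⟩ := exists_eq_mul_conjTranspose h
  exact ⟨fun k x => B x k, by rw [← mul_conjTranspose_eq_sum_ketBra, hB]⟩

theorem partialTraceB_mem_densityMatrices {X Y : Type} [Fintype X] [Fintype Y]
    {ρ : Matrix (X × Y) (X × Y) ℂ} (h : ρ ∈ densityMatrices (X × Y)) :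
    partialTraceB ρ ∈ densityMatrices X := by
  refine ⟨?_, by rw [trace_partialTraceB, h.2]⟩
  obtain ⟨φ, rfl⟩ := exists_eq_sum_ketBra h.1
  rw [partialTraceB_sum]
  exact Matrix.posSemidef_sum _ fun k _ => partialTraceB_ketBra_posSemidef _

/-- The entropy of entanglement built from `R`, as a homogeneous function of vectors. -/
noncomputable def pureEntropy {W X Y : Type} [Fintype W] [Fintype X] [DecidableEq X] [Fintype Y]
    (R : Matrix W W ℂ → ℝ) (φ : X × Y → ℂ) : ℝ :=
  homExt (resourceEntropy R) (partialTraceB (ketBra φ))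

theorem pureEntropy_smul {W X Y : Type} [Fintype W] [Fintype X] [DecidableEq X] [Fintype Y]
    (R : Matrix W W ℂ → ℝ) (c : ℂ) (φ : X × Y → ℂ) :
    pureEntropy R (c • φ) = ‖c‖ ^ 2 * pureEntropy R φ := by
  rw [pureEntropy, ketBra_smul, partialTraceB_smul, homExt_smul, pureEntropy]

theorem pureEntropy_of_isUnitVector {W X Y : Type} [Fintype W] [Fintype X] [DecidableEq X]
    [Fintype Y] (R : Matrix W W ℂ → ℝ) {φ : X × Y → ℂ} (h : IsUnitVector φ) :
    pureEntropy R φ = resourceEntropy R (partialTraceB (ketBra φ)) :=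
  homExt_of_mem _ (partialTraceB_mem_densityMatrices (ketBra_mem_densityMatrices h))

theorem pureEntropy_nonneg {W X Y : Type} [Fintype W] [Fintype X] [DecidableEq X] [Fintype Y]
    {R : Matrix W W ℂ → ℝ} (hn : ∀ σ ∈ densityMatrices W, 0 ≤ R σ)
    (hb : BddAbove (R '' densityMatrices W)) (φ : X × Y → ℂ) : 0 ≤ pureEntropy R φ :=
  homExt_nonneg (fun _ => resourceEntropy_nonneg hn hb) (partialTraceB_ketBra_posSemidef φ)

/-- No signalling: completeness of Bob's Kraus operators makes Alice's unnormalised reduced states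
add up to her initial one. Superadditivity of the concave entropy does the rest. -/
theorem sum_pureEntropy_bob_le {W X Y ι : Type} [Fintype W] [Fintype X] [DecidableEq X] [Fintype Y]
    [DecidableEq Y] [Fintype ι] {R : Matrix W W ℂ → ℝ} (hR : ConvexOn ℝ (densityMatrices W) R)
    (hn : ∀ σ ∈ densityMatrices W, 0 ≤ R σ) (hb : BddAbove (R '' densityMatrices W))
    {V : ι → Type} [∀ i, Fintype (V i)] (M : ∀ i, Matrix (V i) Y ℂ)
    (hM : ∑ i, (M i)ᴴ * M i = 1) (φ : X × Y → ℂ) :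
    ∑ i, pureEntropy R (((1 : Matrix X X ℂ) ⊗ₖ M i) *ᵥ φ) ≤ pureEntropy R φ := by
  refine (sum_homExt_le (concaveOn_resourceEntropy hR hn hb) _
    fun i => partialTraceB_ketBra_posSemidef _).trans (le_of_eq ?_)
  rw [pureEntropy]
  congr 1
  simp only [partialTraceB_ketBra, coeffMatrix_kronecker_mulVec, Matrix.one_mul]
  have h : ∀ i, coeffMatrix φ * (M i)ᵀ * (coeffMatrix φ * (M i)ᵀ)ᴴ =
      coeffMatrix φ * ((M i)ᴴ * M i)ᵀ * (coeffMatrix φ)ᴴ := by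
    intro i
    rw [Matrix.conjTranspose_mul, Matrix.transpose_mul,
      show (M i)ᵀᴴ = (M i)ᴴᵀ from rfl]
    simp only [Matrix.mul_assoc]
  simp only [h]
  rw [← Matrix.sum_mul, ← Matrix.mul_sum, ← Matrix.transpose_sum, hM, Matrix.transpose_one,
    Matrix.mul_one]

/-- The mirror image of Bob's case, after the entropy is read off Bob's reduced state instead of
Alice's. -/
theorem sum_pureEntropy_alice_le {W X Y ι : Type} [Fintype W] [Fintype X] [DecidableEq X]
    [Fintype Y] [DecidableEq Y] [Fintype ι] {R : Matrix W W ℂ → ℝ}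
    (hR : ConvexOn ℝ (densityMatrices W) R)
    (hn : ∀ σ ∈ densityMatrices W, 0 ≤ R σ) (hb : BddAbove (R '' densityMatrices W))
    {V : ι → Type} [∀ i, Fintype (V i)] [∀ i, DecidableEq (V i)] (M : ∀ i, Matrix (V i) X ℂ)
    (hM : ∑ i, (M i)ᴴ * M i = 1) (φ : X × Y → ℂ) :
    ∑ i, pureEntropy R ((M i ⊗ₖ (1 : Matrix Y Y ℂ)) *ᵥ φ) ≤ pureEntropy R φ := by
  have e : ∀ {U : Type} [Fintype U] [DecidableEq U] (χ : U × Y → ℂ), pureEntropy R χ =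
      homExt (resourceEntropy R) ((coeffMatrix χ)ᴴ * coeffMatrix χ)ᵀ := fun χ => by
    rw [pureEntropy, partialTraceB_ketBra, homExt_resourceEntropy_mul_conjTranspose]
  simp only [e]
  refine (sum_homExt_le (concaveOn_resourceEntropy hR hn hb) _
    fun i => (Matrix.posSemidef_conjTranspose_mul_self _).transpose).trans (le_of_eq ?_)
  congr 1
  rw [← Matrix.transpose_sum]
  congr 1
  simp only [coeffMatrix_kronecker_mulVec, Matrix.transpose_one, Matrix.mul_one,
    Matrix.conjTranspose_mul]
  have h : ∀ i, (coeffMatrix φ)ᴴ * (M i)ᴴ * (M i * coeffMatrix φ) =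
      (coeffMatrix φ)ᴴ * ((M i)ᴴ * M i) * coeffMatrix φ := by
    intro i
    simp only [Matrix.mul_assoc]
  simp only [h]
  rw [← Matrix.sum_mul, ← Matrix.mul_sum, hM, Matrix.mul_one]

/-- Induction over the rounds. Since `pureEntropy` is homogeneous, unnormalised vectors carry the
outcome probabilities along. -/
theorem IsLOCC.sum_pureEntropy_le {W : Type} [Fintype W] {R : Matrix W W ℂ → ℝ}
    (hR : ConvexOn ℝ (densityMatrices W) R)
    (hn : ∀ σ ∈ densityMatrices W, 0 ≤ R σ) (hb : BddAbove (R '' densityMatrices W))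
    {X Y : Type} [Fintype X] [DecidableEq X] [Fintype Y] [DecidableEq Y]
    {ι : Type} [Fintype ι] {X' Y' : ι → Type}
    [∀ q, Fintype (X' q)] [∀ q, DecidableEq (X' q)]
    [∀ q, Fintype (Y' q)] [∀ q, DecidableEq (Y' q)]
    {K : ∀ q, Matrix (X' q × Y' q) (X × Y) ℂ} (h : IsLOCC X Y ι X' Y' K) (φ : X × Y → ℂ) :
    ∑ q, pureEntropy R (K q *ᵥ φ) ≤ pureEntropy R φ := by
  induction h with
  | done X Y => simp
  | alice X Y n V M hM κ X' Y' L hL ih =>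
    rw [Fintype.sum_sigma]
    refine le_trans (Finset.sum_le_sum fun i _ => ?_) (sum_pureEntropy_alice_le hR hn hb M hM φ)
    simpa only [Matrix.mulVec_mulVec] using ih i ((M i ⊗ₖ (1 : Matrix Y Y ℂ)) *ᵥ φ)
  | bob X Y n V M hM κ X' Y' L hL ih =>
    rw [Fintype.sum_sigma]
    refine le_trans (Finset.sum_le_sum fun i _ => ?_) (sum_pureEntropy_bob_le hR hn hb M hM φ)
    simpa only [Matrix.mulVec_mulVec] using ih i (((1 : Matrix X X ℂ) ⊗ₖ M i) *ᵥ φ)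

/-! ## The convex roof -/

theorem sum_mul_ketBra_mul_conjTranspose {Z Z' κ : Type} [Fintype Z] [Fintype κ]
    (K : Matrix Z' Z ℂ) (φ : κ → Z → ℂ) :
    K * (∑ k, ketBra (φ k)) * Kᴴ = ∑ k, ketBra (K *ᵥ φ k) := by
  simp only [Matrix.mul_sum, Matrix.sum_mul, mul_ketBra_mul_conjTranspose]

theorem ketBra_kronecker_ketBra {X Y : Type} (u : X → ℂ) (v : Y → ℂ) :
    ketBra u ⊗ₖ ketBra v = ketBra fun p : X × Y => u p.1 * v p.2 := by
  ext ⟨i, j⟩ ⟨i', j'⟩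
  simp only [ketBra, Matrix.kroneckerMap_apply, Matrix.vecMulVec_apply, Pi.star_apply, star_mul']
  ring

theorem kronecker_sum_sum {X Y ι κ : Type} [Fintype ι] [Fintype κ] (A : ι → Matrix X X ℂ)
    (B : κ → Matrix Y Y ℂ) :
    (∑ a, A a) ⊗ₖ (∑ b, B b) = ∑ a, ∑ b, A a ⊗ₖ B b := by
  ext i j
  simp only [Matrix.kroneckerMap_apply, Matrix.sum_apply, Finset.sum_mul_sum]

/-- A pure state has only trivial decompositions. Both sides are evaluated as quadratic forms at
`w`, the component of `φ k` orthogonal to `Ψ`: the right side gives `0`, so `⟨w, φ k⟩ = ⟨w, w⟩ = 0`.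
-/
theorem eq_smul_of_sum_ketBra_eq {Z ι : Type} [Fintype Z] [Fintype ι] {φ : ι → Z → ℂ} {Ψ : Z → ℂ}
    (hΨ : IsUnitVector Ψ) (h : ∑ k, ketBra (φ k) = ketBra Ψ) (k : ι) :
    φ k = (star Ψ ⬝ᵥ φ k) • Ψ := by
  have h1 := star_dotProduct_self_of_isUnitVector hΨ
  set w := φ k - (star Ψ ⬝ᵥ φ k) • Ψ with hw
  have hΨw : star Ψ ⬝ᵥ w = 0 := by
    rw [hw, dotProduct_sub, dotProduct_smul, h1, smul_eq_mul, mul_one, sub_self]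
  have hwΨ : star w ⬝ᵥ Ψ = 0 := by
    rw [Matrix.star_dotProduct, hΨw, star_zero]
  have hq : ∀ χ : Z → ℂ, star w ⬝ᵥ ketBra χ *ᵥ w = star (star w ⬝ᵥ χ) * (star w ⬝ᵥ χ) := by
    intro χ
    rw [ketBra, Matrix.vecMulVec_mulVec, Matrix.star_dotProduct χ w]
    simp [dotProduct_smul, mul_comm]
  have h2 : ∑ j, star (star w ⬝ᵥ φ j) * (star w ⬝ᵥ φ j) = 0 := by
    simp only [← hq]
    rw [← dotProduct_sum, ← Matrix.sum_mulVec, h, hq, hwΨ, mul_zero]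
  have h3 := (Finset.sum_eq_zero_iff_of_nonneg fun j _ => star_mul_self_nonneg _).1 h2 k
    (Finset.mem_univ k)
  have h4 : star w ⬝ᵥ φ k = 0 := by simpa using h3
  have h5 : star w ⬝ᵥ w = 0 := by
    conv_lhs => rw [hw]
    rw [dotProduct_sub, dotProduct_smul, ← hw, h4, hwΨ, smul_zero, sub_zero]
  exact sub_eq_zero.1 (dotProduct_star_self_eq_zero.1 h5)

section

variable {W : Type} [Fintype W] {R : Matrix W W ℂ → ℝ} {X Y : Type} [Fintype X] [DecidableEq X]
  [Fintype Y]

/-- Unnormalised decompositions become ensembles with `P_k = ‖φ k‖²`. A zero vector gets weight `0`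
and an arbitrary unit vector, which requires a nonzero space; the zero space is handled separately.
-/
theorem exists_ensemble (R : Matrix W W ℂ → ℝ) {ι : Type} [Fintype ι] (φ : ι → X × Y → ℂ) :
    ∃ (n : ℕ) (P : Fin n → ℝ) (Ψ : Fin n → X × Y → ℂ),
      (∀ k, 0 ≤ P k) ∧ (∀ k, IsUnitVector (Ψ k)) ∧
      ∑ k, P k • ketBra (Ψ k) = ∑ k, ketBra (φ k) ∧
      ∑ k, pureEntropy R (φ k) =
        ∑ k, P k * resourceEntropy R (partialTraceB (ketBra (Ψ k))) := by
  rcases isEmpty_or_nonempty (X × Y) with hE | hE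
  · refine ⟨0, Fin.elim0, Fin.elim0, fun k => k.elim0, fun k => k.elim0,
      Subsingleton.elim _ _, ?_⟩
    have : ∀ k, pureEntropy R (φ k) = 0 := fun k => by
      rw [pureEntropy, show ketBra (φ k) = (0 : ℝ) • ketBra (φ k) from Subsingleton.elim _ _,
        partialTraceB_smul, homExt_smul, zero_mul]
    simp [this]
  · obtain ⟨χ, hχ⟩ := exists_isUnitVector (X × Y)
    have key : ∀ k, ∃ Ψ : X × Y → ℂ, IsUnitVector Ψ ∧
        φ k = ((√(∑ x, ‖φ k x‖ ^ 2) : ℝ) : ℂ) • Ψ := by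
      intro k
      have hs : 0 ≤ ∑ x, ‖φ k x‖ ^ 2 := Finset.sum_nonneg fun x _ => sq_nonneg _
      rcases eq_or_ne (∑ x, ‖φ k x‖ ^ 2) 0 with h0 | h0
      · refine ⟨χ, hχ, ?_⟩
        rw [h0, Real.sqrt_zero, Complex.ofReal_zero, zero_smul]
        funext x
        have := (Finset.sum_eq_zero_iff_of_nonneg fun x _ => sq_nonneg ‖φ k x‖).1 h0 x
          (Finset.mem_univ x)
        simpa using this
      · refine ⟨_, isUnitVector_normalize rfl h0, ?_⟩
        rw [smul_smul, mul_inv_cancel₀, one_smul]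
        exact_mod_cast (Real.sqrt_ne_zero hs).2 h0
    choose Ψ hΨ hφ using key
    have hsq : ∀ k, ‖((√(∑ x, ‖φ k x‖ ^ 2) : ℝ) : ℂ)‖ ^ 2 = ∑ x, ‖φ k x‖ ^ 2 := fun k => by
      rw [Complex.norm_real, Real.norm_eq_abs, sq_abs,
        Real.sq_sqrt (Finset.sum_nonneg fun x _ => sq_nonneg _)]
    refine ⟨Fintype.card ι, fun j => ∑ x, ‖φ ((Fintype.equivFin ι).symm j) x‖ ^ 2,
      fun j => Ψ ((Fintype.equivFin ι).symm j),
      fun j => Finset.sum_nonneg fun x _ => sq_nonneg _, fun j => hΨ _, ?_, ?_⟩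
    · rw [(Fintype.equivFin ι).symm.sum_comp fun k => (∑ x, ‖φ k x‖ ^ 2) • ketBra (Ψ k)]
      refine Finset.sum_congr rfl fun k _ => ?_
      conv_rhs => rw [hφ k, ketBra_smul, hsq]
    · rw [(Fintype.equivFin ι).symm.sum_comp fun k => (∑ x, ‖φ k x‖ ^ 2) *
        resourceEntropy R (partialTraceB (ketBra (Ψ k)))]
      refine Finset.sum_congr rfl fun k _ => ?_
      conv_lhs => rw [hφ k, pureEntropy_smul, hsq, pureEntropy_of_isUnitVector R (hΨ k)]

theorem convexRoof_set_nonneg (hn : ∀ σ ∈ densityMatrices W, 0 ≤ R σ)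
    (hb : BddAbove (R '' densityMatrices W)) (ρ : Matrix (X × Y) (X × Y) ℂ) :
    ∀ x ∈ {x | ∃ (n : ℕ) (P : Fin n → ℝ) (Ψ : Fin n → X × Y → ℂ),
      (∀ k, 0 ≤ P k) ∧ (∀ k, IsUnitVector (Ψ k)) ∧ ∑ k, P k • ketBra (Ψ k) = ρ ∧
      x = ∑ k, P k * resourceEntropy R (partialTraceB (ketBra (Ψ k)))}, 0 ≤ x := by
  rintro _ ⟨n, P, Ψ, hP, hΨ, -, rfl⟩
  exact Finset.sum_nonneg fun k _ => mul_nonneg (hP k) (resourceEntropy_nonneg hn hb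
    (partialTraceB_mem_densityMatrices (ketBra_mem_densityMatrices (hΨ k))))

theorem pureEntropy_product (hR : ConvexOn ℝ (densityMatrices W) R)
    (hn : ∀ σ ∈ densityMatrices W, 0 ≤ R σ) (hb : BddAbove (R '' densityMatrices W))
    (u : X → ℂ) (v : Y → ℂ) : pureEntropy R (fun p : X × Y => u p.1 * v p.2) = 0 := by
  have h : partialTraceB (ketBra u ⊗ₖ ketBra v) = (∑ y, ‖v y‖ ^ 2) • ketBra u := by
    ext i j
    have hv : ∀ y, v y * star (v y) = ((‖v y‖ ^ 2 : ℝ) : ℂ) := fun y => by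
      rw [Complex.star_def, Complex.mul_conj, Complex.normSq_eq_norm_sq]
    simp only [partialTraceB, Matrix.of_apply, Matrix.kroneckerMap_apply, ← Finset.mul_sum,
      Matrix.smul_apply, ketBra, Matrix.vecMulVec_apply, Pi.star_apply, hv, Complex.real_smul]
    push_cast
    ring
  rw [pureEntropy, ← ketBra_kronecker_ketBra, h, homExt_smul,
    homExt_resourceEntropy_ketBra hR hn hb, mul_zero]

variable [DecidableEq Y]

theorem convexRoof_nonneg (hn : ∀ σ ∈ densityMatrices W, 0 ≤ R σ)
    (hb : BddAbove (R '' densityMatrices W)) (ρ : Matrix (X × Y) (X × Y) ℂ) :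
    0 ≤ convexRoof R X Y ρ :=
  Real.sInf_nonneg (convexRoof_set_nonneg hn hb ρ)

theorem convexRoof_le (hn : ∀ σ ∈ densityMatrices W, 0 ≤ R σ)
    (hb : BddAbove (R '' densityMatrices W)) {ι : Type} [Fintype ι] (φ : ι → X × Y → ℂ) :
    convexRoof R X Y (∑ k, ketBra (φ k)) ≤ ∑ k, pureEntropy R (φ k) := by
  obtain ⟨n, P, Ψ, hP, hΨ, h1, h2⟩ := exists_ensemble R φ
  exact csInf_le ⟨0, convexRoof_set_nonneg hn hb _⟩ ⟨n, P, Ψ, hP, hΨ, h1, h2⟩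

/-- Together with `convexRoof_le`, this characterises the roof by unnormalised decompositions.
Positivity of `ρ` provides an ensemble, without which `sInf ∅ = 0` would intervene. -/
theorem le_convexRoof {ρ : Matrix (X × Y) (X × Y) ℂ} (hρ : ρ.PosSemidef) {c : ℝ}
    (h : ∀ (n : ℕ) (φ : Fin n → X × Y → ℂ), ∑ k, ketBra (φ k) = ρ →
      c ≤ ∑ k, pureEntropy R (φ k)) : c ≤ convexRoof R X Y ρ := by
  refine le_csInf ?_ ?_
  · obtain ⟨φ, rfl⟩ := exists_eq_sum_ketBra hρ
    obtain ⟨n, P, Ψ, hP, hΨ, h1, h2⟩ := exists_ensemble R φ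
    exact ⟨_, n, P, Ψ, hP, hΨ, h1, h2⟩
  · rintro _ ⟨n, P, Ψ, hP, hΨ, h1, rfl⟩
    have hsq : ∀ k, ‖((√(P k) : ℝ) : ℂ)‖ ^ 2 = P k := fun k => by
      rw [Complex.norm_real, Real.norm_eq_abs, sq_abs, Real.sq_sqrt (hP k)]
    refine (h n (fun k => ((√(P k) : ℝ) : ℂ) • Ψ k) ?_).trans (le_of_eq ?_)
    · simp only [ketBra_smul, hsq, h1]
    · refine Finset.sum_congr rfl fun k _ => ?_
      rw [pureEntropy_smul, hsq, pureEntropy_of_isUnitVector R (hΨ k)]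

/-- If the `φ k` decompose `ρ`, then all `K q *ᵥ φ k` together decompose the output. -/
theorem loccMonotone_convexRoof (hR : ConvexOn ℝ (densityMatrices W) R)
    (hn : ∀ σ ∈ densityMatrices W, 0 ≤ R σ) (hb : BddAbove (R '' densityMatrices W)) :
    LOCCMonotone (convexRoof R) := by
  intro X Y _ _ _ _ ι _ X' Y' _ _ _ _ K hK ρ hρ
  refine le_convexRoof hρ.1 ?_
  rintro n φ rfl
  simp only [sum_mul_ketBra_mul_conjTranspose]
  rw [← Fintype.sum_prod_type' fun q k => ketBra (K q *ᵥ φ k)]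
  refine (convexRoof_le hn hb fun p : ι × Fin n => K p.1 *ᵥ φ p.2).trans ?_
  rw [Fintype.sum_prod_type' fun q k => pureEntropy R (K q *ᵥ φ k), Finset.sum_comm]
  exact Finset.sum_le_sum fun k _ => hK.sum_pureEntropy_le hR hn hb (φ k)

theorem loccMonotoneOnAverage_convexRoof (hR : ConvexOn ℝ (densityMatrices W) R)
    (hn : ∀ σ ∈ densityMatrices W, 0 ≤ R σ) (hb : BddAbove (R '' densityMatrices W)) :
    LOCCMonotoneOnAverage (convexRoof R) := by
  intro X Y _ _ _ _ ι _ X' Y' _ _ _ _ K hK ρ hρ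
  refine le_convexRoof hρ.1 ?_
  rintro n φ rfl
  refine le_trans (Finset.sum_le_sum fun q _ => ?_)
    ((Finset.sum_comm (f := fun q k => pureEntropy R (K q *ᵥ φ k))).trans_le
      (Finset.sum_le_sum fun k _ => hK.sum_pureEntropy_le hR hn hb (φ k)))
  rw [outcomeState]
  set p := outcomeProb (K q) (∑ k, ketBra (φ k)) with hp
  have hp0 : 0 ≤ p := trace_re_nonneg (hρ.1.mul_mul_conjTranspose_same (K q))
  rcases hp0.eq_or_lt with h0 | h0
  · rw [← h0, zero_mul]
    exact Finset.sum_nonneg fun k _ => pureEntropy_nonneg hn hb _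
  have hsq : ‖((√p : ℝ)⁻¹ : ℂ)‖ ^ 2 = p⁻¹ := by
    rw [norm_inv, Complex.norm_real, Real.norm_eq_abs, inv_pow, sq_abs, Real.sq_sqrt hp0]
  -- For fixed `q` these vectors decompose the normalised state of that outcome.
  have h1 := convexRoof_le hn hb fun k => ((√p : ℝ)⁻¹ : ℂ) • K q *ᵥ φ k
  simp only [ketBra_smul, pureEntropy_smul, hsq] at h1
  rw [← Finset.smul_sum, ← Finset.mul_sum, ← sum_mul_ketBra_mul_conjTranspose] at h1
  refine (mul_le_mul_of_nonneg_left h1 hp0).trans (le_of_eq ?_)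
  rw [← mul_assoc, mul_inv_cancel₀ h0.ne', one_mul]

/-- Decomposing both factors of each product state yields an ensemble of product vectors, whose
reduced states are pure. -/
theorem convexRoof_of_isSeparableState (hR : ConvexOn ℝ (densityMatrices W) R)
    (hn : ∀ σ ∈ densityMatrices W, 0 ≤ R σ) (hb : BddAbove (R '' densityMatrices W))
    {ρ : Matrix (X × Y) (X × Y) ℂ} (hρ : IsSeparableState ρ) : convexRoof R X Y ρ = 0 := by
  refine le_antisymm ?_ (convexRoof_nonneg hn hb ρ)
  obtain ⟨n, p, σ, τ, hp, -, hσ, hτ, rfl⟩ := hρ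
  choose u hu using fun k => exists_eq_sum_ketBra (hσ k).1
  choose v hv using fun k => exists_eq_sum_ketBra (hτ k).1
  have hsq : ∀ k, ‖((√(p k) : ℝ) : ℂ)‖ ^ 2 = p k := fun k => by
    rw [Complex.norm_real, Real.norm_eq_abs, sq_abs, Real.sq_sqrt (hp k)]
  have h := convexRoof_le hn hb fun t : Fin n × X × Y =>
    ((√(p t.1) : ℝ) : ℂ) • fun q : X × Y => u t.1 t.2.1 q.1 * v t.1 t.2.2 q.2
  simp only [ketBra_smul, pureEntropy_smul, pureEntropy_product hR hn hb, hsq, mul_zero,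
    Finset.sum_const_zero, ← ketBra_kronecker_ketBra, Fintype.sum_prod_type, ← Finset.smul_sum,
    ← kronecker_sum_sum, hu, hv] at h
  exact h

theorem isEntanglementMonotone_convexRoof (hR : ConvexOn ℝ (densityMatrices W) R)
    (hn : ∀ σ ∈ densityMatrices W, 0 ≤ R σ) (hb : BddAbove (R '' densityMatrices W)) :
    IsEntanglementMonotone (convexRoof R) where
  nonneg _ _ _ _ _ _ ρ _ := convexRoof_nonneg hn hb ρ
  separable _ _ _ _ _ _ _ hρ := convexRoof_of_isSeparableState hR hn hb hρ
  monotone := Or.inl (loccMonotone_convexRoof hR hn hb)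

theorem convexRoof_le_resourceEntropy (hR : ConvexOn ℝ (densityMatrices W) R)
    (hn : ∀ σ ∈ densityMatrices W, 0 ≤ R σ) (hb : BddAbove (R '' densityMatrices W))
    {ρ : Matrix (X × Y) (X × Y) ℂ} (hρ : ρ ∈ densityMatrices (X × Y)) :
    convexRoof R X Y ρ ≤ resourceEntropy R (partialTraceB ρ) := by
  rw [← homExt_of_mem (resourceEntropy R) (partialTraceB_mem_densityMatrices hρ)]
  obtain ⟨φ, rfl⟩ := exists_eq_sum_ketBra hρ.1
  rw [partialTraceB_sum]
  exact (convexRoof_le hn hb φ).trans (sum_homExt_le (concaveOn_resourceEntropy hR hn hb) _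
    fun k => partialTraceB_ketBra_posSemidef _)

/-- Every decomposition consists of multiples of `Ψ` whose squared norms sum to one, so all give the
same value. -/
theorem resourceEntropy_le_convexRoof_ketBra {Ψ : X × Y → ℂ} (hΨ : IsUnitVector Ψ) :
    resourceEntropy R (partialTraceB (ketBra Ψ)) ≤ convexRoof R X Y (ketBra Ψ) := by
  refine le_convexRoof (ketBra_posSemidef Ψ) fun n φ hφ => le_of_eq ?_
  have hk := eq_smul_of_sum_ketBra_eq hΨ hφ
  have htr : ∑ k, ‖star Ψ ⬝ᵥ φ k‖ ^ 2 = 1 := by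
    have h1 : ∑ k, ketBra (φ k) = (∑ k, ‖star Ψ ⬝ᵥ φ k‖ ^ 2) • ketBra Ψ := by
      rw [Finset.sum_smul]
      refine Finset.sum_congr rfl fun k _ => ?_
      conv_lhs => rw [hk k, ketBra_smul]
    have h2 := congrArg Matrix.trace h1
    rw [hφ, Matrix.trace_smul, (ketBra_mem_densityMatrices hΨ).2, Complex.real_smul, mul_one] at h2
    exact_mod_cast h2.symm
  have h3 : ∀ k, pureEntropy R (φ k) = ‖star Ψ ⬝ᵥ φ k‖ ^ 2 * pureEntropy R Ψ := fun k => by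
    conv_lhs => rw [hk k, pureEntropy_smul]
  simp only [h3]
  rw [← Finset.sum_mul, htr, one_mul, pureEntropy_of_isUnitVector R hΨ]

theorem isMaxOverExtensions_convexRoof (hR : ConvexOn ℝ (densityMatrices W) R)
    (hn : ∀ σ ∈ densityMatrices W, 0 ≤ R σ) (hb : BddAbove (R '' densityMatrices W))
    (Z : Type) [Fintype Z] [DecidableEq Z] :
    IsMaxOverExtensions Z (fun σ => resourceEntropy R σ) (convexRoof R) := by
  intro σ hσ
  constructor
  -- The maximum is attained at a purification on two copies of `ℂ^Z`: the vector with coefficient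
  -- matrix `B`, where `σ = B B†`.
  · obtain ⟨B, hB⟩ := exists_eq_mul_conjTranspose hσ.1
    have hpt : partialTraceB (ketBra fun p : Z × Z => B p.1 p.2) = σ := by
      rw [partialTraceB_ketBra, ← hB]
      rfl
    have hΨ : IsUnitVector fun p : Z × Z => B p.1 p.2 := by
      have h := trace_ketBra fun p : Z × Z => B p.1 p.2
      rw [← trace_partialTraceB, hpt, hσ.2] at h
      exact_mod_cast h.symm
    have hmem := ketBra_mem_densityMatrices hΨ
    refine ⟨Z, inferInstance, inferInstance, _, hmem, hpt, le_antisymm ?_ ?_⟩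
    · have h := resourceEntropy_le_convexRoof_ketBra (R := R) hΨ
      rwa [hpt] at h
    · have h := convexRoof_le_resourceEntropy hR hn hb hmem
      rwa [hpt] at h
  · rintro _ ⟨Y, _, _, ρ, hρ, rfl, rfl⟩
    exact convexRoof_le_resourceEntropy hR hn hb hρ

theorem add_le_stateSup [DecidableEq W] (hb : BddAbove (R '' densityMatrices W))
    {E : BipartiteFunction}
    (hE : IsMaxOverExtensions W (fun σ => resourceEntropy R σ) E)
    {ρ : Matrix (W × Y) (W × Y) ℂ} (hρ : ρ ∈ densityMatrices (W × Y)) :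
    R (partialTraceB ρ) + E W Y ρ ≤ stateSup R := by
  have hmem := partialTraceB_mem_densityMatrices hρ
  have h1 : E W Y ρ ≤ resourceEntropy R (partialTraceB ρ) :=
    (hE _ hmem).2 ⟨Y, inferInstance, inferInstance, ρ, hρ, rfl, rfl⟩
  have h2 := le_spectralSup_self hb hmem
  rw [resourceEntropy] at h1
  linarith

end

/-! ## Convex hulls of functions of states -/

section

variable {X : Type} [Fintype X] {R : Matrix X X ℂ → ℝ}

theorem le_convexHullFunction {g : Matrix X X ℂ → ℝ} (hg : ConvexOn ℝ (densityMatrices X) g)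
    (hgR : ∀ σ ∈ densityMatrices X, g σ ≤ R σ) {ρ : Matrix X X ℂ} (hρ : ρ ∈ densityMatrices X) :
    g ρ ≤ convexHullFunction R ρ := by
  refine le_csSup ⟨R ρ, ?_⟩ ⟨g, hg, hgR, rfl⟩
  rintro _ ⟨g, -, h, rfl⟩
  exact h ρ hρ

theorem convexHullFunction_le_of_forall (hn : ∀ σ ∈ densityMatrices X, 0 ≤ R σ)
    {ρ : Matrix X X ℂ} {c : ℝ}
    (h : ∀ g : Matrix X X ℂ → ℝ, ConvexOn ℝ (densityMatrices X) g →
      (∀ σ ∈ densityMatrices X, g σ ≤ R σ) → g ρ ≤ c) : convexHullFunction R ρ ≤ c := by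
  refine csSup_le ⟨0, fun _ => 0, convexOn_const _ (convex_densityMatrices X), hn, rfl⟩ ?_
  rintro _ ⟨g, hg, hgR, rfl⟩
  exact h g hg hgR

theorem convexHullFunction_le (hn : ∀ σ ∈ densityMatrices X, 0 ≤ R σ) {ρ : Matrix X X ℂ}
    (hρ : ρ ∈ densityMatrices X) : convexHullFunction R ρ ≤ R ρ :=
  convexHullFunction_le_of_forall hn fun _ _ h => h ρ hρ

theorem convexHullFunction_nonneg (hn : ∀ σ ∈ densityMatrices X, 0 ≤ R σ) {ρ : Matrix X X ℂ}
    (hρ : ρ ∈ densityMatrices X) : 0 ≤ convexHullFunction R ρ :=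
  le_convexHullFunction (g := fun _ => 0) (convexOn_const _ (convex_densityMatrices X)) hn hρ

/-- A pointwise supremum of convex functions is convex. Non-negativity of `R` makes `0` a minorant,
so the supremum is over a nonempty set. -/
theorem convexOn_convexHullFunction (hn : ∀ σ ∈ densityMatrices X, 0 ≤ R σ) :
    ConvexOn ℝ (densityMatrices X) (convexHullFunction R) := by
  refine ⟨convex_densityMatrices X, fun ρ hρ σ hσ a b ha hb hab => ?_⟩
  refine convexHullFunction_le_of_forall hn fun g hg hgR => ?_
  exact (hg.2 hρ hσ ha hb hab).trans (add_le_add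
    (smul_le_smul_of_nonneg_left (le_convexHullFunction hg hgR hρ) ha)
    (smul_le_smul_of_nonneg_left (le_convexHullFunction hg hgR hσ) hb))

end

/-! ## Kraus operators -/

section

variable {X ι : Type} [Fintype X] [Fintype ι]

theorem sum_kraus_mem_densityMatrices {X' : Type} [DecidableEq X] [Fintype X']
    {K : ι → Matrix X' X ℂ}
    (hK : ∑ q, (K q)ᴴ * K q = 1) {ρ : Matrix X X ℂ} (hρ : ρ ∈ densityMatrices X) :
    ∑ q, K q * ρ * (K q)ᴴ ∈ densityMatrices X' := by
  refine ⟨Matrix.posSemidef_sum _ fun q _ => hρ.1.mul_mul_conjTranspose_same _, ?_⟩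
  rw [Matrix.trace_sum]
  simp only [fun q => Matrix.trace_mul_comm (K q * ρ) (K q)ᴴ, ← Matrix.mul_assoc]
  rw [← Matrix.trace_sum, ← Matrix.sum_mul, hK, Matrix.one_mul, hρ.2]

theorem sum_kraus_combo {X' : Type} (K : ι → Matrix X' X ℂ) (ρ σ : Matrix X X ℂ) (a b : ℝ) :
    ∑ q, K q * (a • ρ + b • σ) * (K q)ᴴ =
      a • ∑ q, K q * ρ * (K q)ᴴ + b • ∑ q, K q * σ * (K q)ᴴ := by
  simp only [Matrix.mul_add, Matrix.add_mul, Matrix.mul_smul, Matrix.smul_mul,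
    Finset.sum_add_distrib, Finset.smul_sum]

theorem convexOn_comp_sum_kraus {X' : Type} [DecidableEq X] [Fintype X'] {K : ι → Matrix X' X ℂ}
    (hK : ∑ q, (K q)ᴴ * K q = 1) {g : Matrix X' X' ℂ → ℝ}
    (hg : ConvexOn ℝ (densityMatrices X') g) :
    ConvexOn ℝ (densityMatrices X) fun ρ => g (∑ q, K q * ρ * (K q)ᴴ) := by
  refine ⟨convex_densityMatrices X, fun ρ hρ σ hσ a b ha hb hab => ?_⟩
  dsimp only
  rw [sum_kraus_combo]
  exact hg.2 (sum_kraus_mem_densityMatrices hK hρ) (sum_kraus_mem_densityMatrices hK hσ) ha hb hab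

theorem outcomeProb_mul_eq_homExt {X' : Type} [Fintype X'] (g : Matrix X' X' ℂ → ℝ)
    (K : Matrix X' X ℂ) (ρ : Matrix X X ℂ) :
    outcomeProb K ρ * g (outcomeState K ρ) = homExt g (K * ρ * Kᴴ) :=
  rfl

/-- The normalised outcome is not linear in `ρ`, but each summand is `homExt` of the linear `K ρ
K†`, and `homExt` is subadditive and homogeneous. -/
theorem convexOn_sum_outcome {X' : ι → Type} [∀ q, Fintype (X' q)]
    (K : ∀ q, Matrix (X' q) X ℂ) {g : ∀ q, Matrix (X' q) (X' q) ℂ → ℝ}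
    (hg : ∀ q, ConvexOn ℝ (densityMatrices (X' q)) (g q)) :
    ConvexOn ℝ (densityMatrices X) fun ρ =>
      ∑ q, outcomeProb (K q) ρ * g q (outcomeState (K q) ρ) := by
  refine ⟨convex_densityMatrices X, fun ρ hρ σ hσ a b ha hb hab => ?_⟩
  simp only [outcomeProb_mul_eq_homExt, smul_eq_mul, Finset.mul_sum, ← Finset.sum_add_distrib]
  refine Finset.sum_le_sum fun q _ => ?_
  rw [Matrix.mul_add, Matrix.add_mul, Matrix.mul_smul, Matrix.mul_smul, Matrix.smul_mul,
    Matrix.smul_mul, ← homExt_smul, ← homExt_smul]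
  exact homExt_add_le (hg q) ((hρ.1.mul_mul_conjTranspose_same _).smul ha)
    ((hσ.1.mul_mul_conjTranspose_same _).smul hb)

end

/-! ## Convex hulls of measures of a resource -/

namespace ResourceTheory

variable {T : ResourceTheory} {R : ResourceFunction}

theorem monotoneOnAverageFor_hull (hn : ∀ d, ∀ ρ ∈ densityMatrices (SpaceIndex d), 0 ≤ R d ρ)
    (h : T.MonotoneOnAverageFor R) : T.MonotoneOnAverageFor R.hull := by
  intro d n t K hK ρ hρ
  -- The average of the hull over the outcomes, as a function of `ρ`, is a convex minorant of `R d`.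
  refine le_convexHullFunction (convexOn_sum_outcome K
    fun q => convexOn_convexHullFunction (hn (t q))) (fun σ hσ => ?_) hρ
  refine le_trans (Finset.sum_le_sum fun q _ => ?_) (h d n t K hK σ hσ)
  exact homExt_mono (fun τ hτ => convexHullFunction_le (hn (t q)) hτ)
    (hσ.1.mul_mul_conjTranspose_same (K q))

theorem monotoneFor_hull (hR : T.IsMeasure R) : T.MonotoneFor R.hull := by
  intro d d' n K hK ρ hρ
  have hc := T.freeOp_complete _ _ _ _ hK
  have hn := hR.nonneg
  refine le_convexHullFunction (convexOn_comp_sum_kraus hc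
    (convexOn_convexHullFunction (hn d'))) (fun σ hσ => ?_) hρ
  rcases hR.monotone with h | h
  · exact (convexHullFunction_le (hn d') (sum_kraus_mem_densityMatrices hc hσ)).trans
      (h d d' n K hK σ hσ)
  · refine le_trans ?_ (h d n _ K hK σ hσ)
    rw [← homExt_of_mem (convexHullFunction (R d')) (sum_kraus_mem_densityMatrices hc hσ)]
    have hpos := fun q => hσ.1.mul_mul_conjTranspose_same (K q)
    refine (homExt_sum_le (convexOn_convexHullFunction (hn d')) _ hpos).trans
      (Finset.sum_le_sum fun q _ => ?_)
    exact homExt_mono (fun τ hτ => convexHullFunction_le (hn d') hτ) (hpos q)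

theorem isMeasure_hull (hR : T.IsMeasure R) : T.IsMeasure R.hull where
  nonneg d _ hρ := convexHullFunction_nonneg (hR.nonneg d) hρ
  free d ρ hρ := by
    have hmem := T.free_subset d hρ
    refine le_antisymm ?_ (convexHullFunction_nonneg (hR.nonneg d) hmem)
    rw [← hR.free d ρ hρ]
    exact convexHullFunction_le (hR.nonneg d) hmem
  monotone := Or.inl (monotoneFor_hull hR)

end ResourceTheory

theorem mainTheorem1 :
    -- convex, non-negative and bounded functions of the states of A
    (∀ (X : Type) [Fintype X] [DecidableEq X] [Nonempty X] (R : Matrix X X ℂ → ℝ),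
      ConvexOn ℝ (densityMatrices X) R → (∀ σ ∈ densityMatrices X, 0 ≤ R σ) →
      BddAbove (R '' densityMatrices X) →
        (IsLUB (R '' densityMatrices X) (stateSup R) ∧
          ∀ (Z : Type) [Fintype Z] [DecidableEq Z] (ψ : Z → ℂ), IsUnitVector ψ →
            spectralSup R (ketBra ψ) = stateSup R) ∧
        (∀ E : BipartiteFunction, IsEntanglementMonotone E →
          IsMaxOverExtensions X (fun σ => resourceEntropy R σ) E →
          ∀ (Y : Type) [Fintype Y] [DecidableEq Y], ∀ ρ ∈ densityMatrices (X × Y),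
            R (partialTraceB ρ) + E X Y ρ ≤ stateSup R) ∧
        IsEntanglementMonotone (convexRoof R) ∧
        LOCCMonotone (convexRoof R) ∧ LOCCMonotoneOnAverage (convexRoof R) ∧
        (∀ (Z : Type) [Fintype Z] [DecidableEq Z],
          IsMaxOverExtensions Z (fun σ => resourceEntropy R σ) (convexRoof R)) ∧
        (∀ (Y : Type) [Fintype Y] [DecidableEq Y], ∀ ρ ∈ densityMatrices (X × Y),
          R (partialTraceB ρ) + convexRoof R X Y ρ ≤ stateSup R)) ∧
    -- every resource with a measure: its convex hull is a convex measure, with the same inequality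
    (∀ (T : ResourceTheory) (R : ResourceFunction), T.IsMeasure R →
      T.IsMeasure R.hull ∧ T.MonotoneFor R.hull ∧
      (T.MonotoneOnAverageFor R → T.MonotoneOnAverageFor R.hull) ∧
      ∀ d : List ℕ+,
        ConvexOn ℝ (densityMatrices (SpaceIndex d)) (R.hull d) ∧
        (∀ σ ∈ densityMatrices (SpaceIndex d), R.hull d σ ≤ R d σ) ∧
        (∀ g : Matrix (SpaceIndex d) (SpaceIndex d) ℂ → ℝ,
          ConvexOn ℝ (densityMatrices (SpaceIndex d)) g →
          (∀ σ ∈ densityMatrices (SpaceIndex d), g σ ≤ R d σ) →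
          ∀ σ ∈ densityMatrices (SpaceIndex d), g σ ≤ R.hull d σ) ∧
        (BddAbove (R.hull d '' densityMatrices (SpaceIndex d)) →
          (∀ E : BipartiteFunction, IsEntanglementMonotone E →
            IsMaxOverExtensions (SpaceIndex d) (fun σ => resourceEntropy (R.hull d) σ) E →
            ∀ (Y : Type) [Fintype Y] [DecidableEq Y],
              ∀ ρ ∈ densityMatrices (SpaceIndex d × Y),
                R.hull d (partialTraceB ρ) + E (SpaceIndex d) Y ρ ≤ stateSup (R.hull d)) ∧
          IsEntanglementMonotone (convexRoof (R.hull d)) ∧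
          (∀ (Z : Type) [Fintype Z] [DecidableEq Z],
            IsMaxOverExtensions Z (fun σ => resourceEntropy (R.hull d) σ) (convexRoof (R.hull d))) ∧
          (∀ (Y : Type) [Fintype Y] [DecidableEq Y],
            ∀ ρ ∈ densityMatrices (SpaceIndex d × Y),
              R.hull d (partialTraceB ρ) + convexRoof (R.hull d) (SpaceIndex d) Y ρ
                ≤ stateSup (R.hull d)))) := by
  refine ⟨fun X _ _ _ R hR hn hb => ⟨⟨isLUB_stateSup hb, fun Z _ _ ψ hψ =>
      spectralSup_ketBra hR hn hb hψ⟩, fun E _ hE Y _ _ ρ hρ => add_le_stateSup hb hE hρ,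
      isEntanglementMonotone_convexRoof hR hn hb, loccMonotone_convexRoof hR hn hb,
      loccMonotoneOnAverage_convexRoof hR hn hb, isMaxOverExtensions_convexRoof hR hn hb,
      fun Y _ _ ρ hρ => add_le_stateSup hb (isMaxOverExtensions_convexRoof hR hn hb X) hρ⟩,
    fun T R hR => ⟨ResourceTheory.isMeasure_hull hR,
      ResourceTheory.monotoneFor_hull hR, ResourceTheory.monotoneOnAverageFor_hull hR.nonneg,
      fun d => ?_⟩⟩
  have hn := hR.nonneg d
  have hconv : ConvexOn ℝ (densityMatrices (SpaceIndex d)) (R.hull d) :=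
    convexOn_convexHullFunction hn
  have hnn : ∀ σ ∈ densityMatrices (SpaceIndex d), 0 ≤ R.hull d σ :=
    fun σ hσ => convexHullFunction_nonneg hn hσ
  exact ⟨hconv, fun σ hσ => convexHullFunction_le hn hσ,
    fun g hg hgR σ hσ => le_convexHullFunction hg hgR hσ,
    fun hb => ⟨fun E _ hE Y _ _ ρ hρ => add_le_stateSup hb hE hρ,
      isEntanglementMonotone_convexRoof hconv hnn hb,
      isMaxOverExtensions_convexRoof hconv hnn hb,
      fun Y _ _ ρ hρ => add_le_stateSup hb (isMaxOverExtensions_convexRoof hconv hnn hb _) hρ⟩⟩
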